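/- Let $n,m\ge 2$, let $q\in\mathbb C$ with $|q|=1$, and let $\varphi_0\in\mathbb R$ with $q=e^{2\pi i\varphi_0}$. Let $\mathcal E_{n,m}^q$ be the universal unital $C^*$-algebra generated by $s_1,\dots,s_n,t_1,\dots,t_m$ subject to $$s_i^*s_j=\delta_{ij}\mathbf 1,\qquad t_r^*t_l=\delta_{rl}\mathbf 1,\qquad s_j^*t_r=q\,t_rs_j^* .$$ Let $\mathcal O_k^{(0)}$ be the Cuntz–Toeplitz algebra, i.e. the universal unital $C^*$-algebra generated by $s_1,\dots,s_k$ subject to $s_i^*s_j=\delta_{ij}\mathbf 1$. It is nuclear, so that $A=\mathcal O_n^{(0)}\otimes\mathcal O_m^{(0)}$ is unambiguous as a $C^*$-tensor product. Let $\alpha$ be the action of $\mathbb R^2$ on $A$ that comes from the gauge action of $\mathbb T^2$: $$\alpha_x(s_j\otimes\mathbf 1)=e^{2\pi i x_1}\,s_j\otimes\mathbf 1,\qquad \alpha_x(\mathbf 1\otimes s_r)=e^{2\pi i x_2}\,\mathbf 1\otimes s_r,$$ and put $$\Theta_q=\begin{pmatrix}0&\varphi_0/2\\-\varphi_0/2&0\end{pmatrix}.$$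 Let $A_{\Theta_q}$ be the Rieffel deformation of $A$ along $\alpha$, that is, the $C^*$-completion of the algebra $A_\infty$ of smooth vectors of $\alpha$ with the involution of $A$ and the product given by the oscillatory integral $$a\cdot_{\Theta_q}b=\int_{\mathbb R^2}\int_{\mathbb R^2}\alpha_{\Theta_q x}(a)\,\alpha_y(b)\,e^{2\pi i\langle x,y\rangle}\,dx\,dy .$$ Its $C^*$-norm is the norm of the left multiplication operators $$(L_af)(x)=\int\!\!\int\pi(\alpha_{x+\Theta_q u}(a))f(x+v)\,e^{2\pi i\langle u,v\rangle}\,dv\,du$$ on $L^2(\mathbb R^2,H)$ (given by this formula for Schwartz functions $f$), where $\pi$ is a faithful unital representation of $A$ on a Hilbert space $H$. Equivalently, $A_{\Theta_q}$ is the $C^*$-algebra generated by the operators $L_a$, $a\in A_\infty$; up to isomorphism it does not depend on $\pi$. Then, for every choice of $\pi$, the $C^*$-algebras are $*$-isomorphic: $$\mathcal E_{n,m}^q\;\cong\;(\mathcal O_n^{(0)}\otimes\mathcal O_m^{(0)})_{\Theta_q}.$$ -/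

import Mathlib

open scoped TensorProduct SchwartzMap ContDiff
open MeasureTheory

set_option linter.unusedSectionVars false

noncomputable section

/-! ## The free unital `*`-algebra -/

/-- The free unital complex `*`-algebra on `X`: noncommutative polynomials in the letters
`x = Sum.inl x` and `x^* = Sum.inr x`, with the conjugate-linear involution exchanging them. -/
def FreeStarAlgebra (X : Type*) : Type _ := FreeAlgebra ℂ (X ⊕ X)

namespace FreeStarAlgebra

variable {X : Type*}

instance : Ring (FreeStarAlgebra X) := inferInstanceAs (Ring (FreeAlgebra ℂ (X ⊕ X)))

instance : Algebra ℂ (FreeStarAlgebra X) := inferInstanceAs (Algebra ℂ (FreeAlgebra ℂ (X ⊕ X)))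

/-- The letters of the free `*`-algebra, including the formal adjoints. -/
def letter (y : X ⊕ X) : FreeStarAlgebra X := FreeAlgebra.ι ℂ y

/-- The generators of the free `*`-algebra. -/
def gen (x : X) : FreeStarAlgebra X := letter (Sum.inl x)

@[elab_as_elim]
theorem induction {C : FreeStarAlgebra X → Prop}
    (scalar : ∀ r : ℂ, C (algebraMap ℂ (FreeStarAlgebra X) r)) (letter : ∀ y, C (letter y))
    (mul : ∀ a b, C a → C b → C (a * b)) (add : ∀ a b, C a → C b → C (a + b))
    (a : FreeStarAlgebra X) : C a :=
  FreeAlgebra.induction ℂ (X ⊕ X) scalar letter mul add a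

/-- The opposite of the free `*`-algebra, with scalars acting through complex conjugation. -/
def ConjOpposite (X : Type*) : Type _ := (FreeStarAlgebra X)ᵐᵒᵖ

instance : Ring (ConjOpposite X) := inferInstanceAs (Ring (FreeStarAlgebra X)ᵐᵒᵖ)

instance : Algebra ℂ (ConjOpposite X) :=
  RingHom.toAlgebra' ((algebraMap ℂ (FreeStarAlgebra X)ᵐᵒᵖ).comp (starRingEnd ℂ))
    (fun c x => Algebra.commutes (starRingEnd ℂ c) (show (FreeStarAlgebra X)ᵐᵒᵖ from x))

/-- The involution as an algebra homomorphism to the conjugate opposite algebra. -/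
def starHom (X : Type*) : FreeStarAlgebra X →ₐ[ℂ] ConjOpposite X :=
  FreeAlgebra.lift ℂ (fun y : X ⊕ X => MulOpposite.op (letter y.swap))

instance : Star (FreeStarAlgebra X) where
  star a := MulOpposite.unop (starHom X a)

theorem star_mul' (a b : FreeStarAlgebra X) : star (a * b) = star b * star a := by
  change MulOpposite.unop (starHom X (a * b)) = _
  rw [map_mul]; rfl

theorem star_add' (a b : FreeStarAlgebra X) : star (a + b) = star a + star b := by
  change MulOpposite.unop (starHom X (a + b)) = _
  rw [map_add]; rfl

theorem star_letter (y : X ⊕ X) : star (letter y) = letter y.swap := by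
  exact congrArg MulOpposite.unop (FreeAlgebra.lift_ι_apply (R := ℂ) (A := ConjOpposite X)
    (fun y : X ⊕ X => MulOpposite.op (letter y.swap)) y)

theorem star_algebraMap' (c : ℂ) : star (algebraMap ℂ (FreeStarAlgebra X) c)
    = algebraMap ℂ (FreeStarAlgebra X) (star c) := by
  change MulOpposite.unop (starHom X (algebraMap ℂ (FreeStarAlgebra X) c)) = _
  rw [AlgHom.commutes]; rfl

instance : StarRing (FreeStarAlgebra X) where
  star_involutive a := by
    induction a using FreeStarAlgebra.induction with
    | scalar r => rw [star_algebraMap', star_algebraMap', star_star]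
    | letter y => rw [star_letter, star_letter, Sum.swap_swap]
    | mul a b ha hb => rw [star_mul', star_mul', ha, hb]
    | add a b ha hb => rw [star_add', star_add', ha, hb]
  star_mul := star_mul'
  star_add := star_add'

instance : StarModule ℂ (FreeStarAlgebra X) where
  star_smul c a := by
    rw [Algebra.smul_def, star_mul, star_algebraMap', ← Algebra.commutes, Algebra.smul_def]

variable {B : Type*} [Ring B] [StarRing B] [Algebra ℂ B] [StarModule ℂ B]

/-- The universal property of the free `*`-algebra. -/
def lift (f : X → B) : FreeStarAlgebra X →⋆ₐ[ℂ] B :=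
  let φ : FreeStarAlgebra X →ₐ[ℂ] B := FreeAlgebra.lift ℂ (Sum.elim f (fun x => star (f x)))
  have hφ : ∀ y, φ (letter y) = Sum.elim f (fun x => star (f x)) y :=
    fun y => FreeAlgebra.lift_ι_apply _ y
  { φ with
    map_star' := fun a => by
      change φ (star a) = star (φ a)
      induction a using FreeStarAlgebra.induction with
      | scalar r =>
        rw [star_algebraMap', AlgHom.commutes, AlgHom.commutes, algebraMap_star_comm]
      | letter y =>
        rw [star_letter, hφ, hφ]
        cases y <;> simp
      | mul a b ha hb => rw [star_mul, map_mul, map_mul, star_mul, ha, hb]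
      | add a b ha hb => rw [star_add, map_add, map_add, star_add, ha, hb] }

@[simp]
theorem lift_gen (f : X → B) (x : X) : lift f (gen x) = f x :=
  FreeAlgebra.lift_ι_apply (R := ℂ) (Sum.elim f (fun x => star (f x))) (Sum.inl x)

theorem letter_inr (x : X) : letter (Sum.inr x) = star (gen x) := by
  rw [gen, star_letter]; rfl

theorem hom_ext {φ ψ : FreeStarAlgebra X →⋆ₐ[ℂ] B} (h : ∀ x, φ (gen x) = ψ (gen x)) : φ = ψ := by
  ext a
  induction a using FreeStarAlgebra.induction with
  | scalar r => rw [AlgHomClass.commutes, AlgHomClass.commutes]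
  | letter y =>
    cases y with
    | inl x => exact h x
    | inr x => rw [letter_inr, map_star, map_star, h x]
  | mul a b ha hb => rw [map_mul, map_mul, ha, hb]
  | add a b ha hb => rw [map_add, map_add, ha, hb]

end FreeStarAlgebra

/-! ## `C^*`-seminorms and their completions -/

/-- A `C^*`-seminorm on a complex `*`-algebra. -/
structure IsCStarSeminorm {P : Type*} [Ring P] [StarRing P] [Algebra ℂ P] (p : P → ℝ) : Prop where
  add_le : ∀ x y, p (x + y) ≤ p x + p y
  smul : ∀ (c : ℂ) x, p (c • x) = ‖c‖ * p x
  mul_le : ∀ x y, p (x * y) ≤ p x * p y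
  star_mul_self : ∀ x, p (star x * x) = p x ^ 2

namespace IsCStarSeminorm

variable {P : Type*} [Ring P] [StarRing P] [Algebra ℂ P] {p : P → ℝ}

theorem zero (hp : IsCStarSeminorm p) : p 0 = 0 := by
  simpa using hp.smul 0 0

theorem neg (hp : IsCStarSeminorm p) (x : P) : p (-x) = p x := by
  simpa using hp.smul (-1) x

theorem nonneg (hp : IsCStarSeminorm p) (x : P) : 0 ≤ p x := by
  have h := hp.add_le x (-x)
  rw [add_neg_cancel, hp.zero, hp.neg] at h
  linarith

theorem le_star (hp : IsCStarSeminorm p) (x : P) : p x ≤ p (star x) := by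
  have h := hp.mul_le (star x) x
  rw [hp.star_mul_self] at h
  by_contra! hlt
  have h0 := hp.nonneg (star x)
  nlinarith

theorem star_eq (hp : IsCStarSeminorm p) (x : P) : p (star x) = p x :=
  le_antisymm (by simpa using hp.le_star (star x)) (hp.le_star x)

theorem one_le (hp : IsCStarSeminorm p) : p 1 ≤ 1 := by
  have h := hp.star_mul_self 1
  rw [star_one, one_mul] at h
  by_contra! hlt
  nlinarith

theorem algebraMap_le (hp : IsCStarSeminorm p) (c : ℂ) : p (algebraMap ℂ P c) ≤ ‖c‖ := by
  rw [Algebra.algebraMap_eq_smul_one, hp.smul]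
  exact mul_le_of_le_one_right (norm_nonneg _) hp.one_le

theorem comp (hp : IsCStarSeminorm p) {Q : Type*} [Ring Q] [StarRing Q] [Algebra ℂ Q]
    (f : Q →⋆ₐ[ℂ] P) : IsCStarSeminorm (fun x => p (f x)) where
  add_le x y := by rw [map_add]; exact hp.add_le _ _
  smul c x := by rw [map_smul]; exact hp.smul _ _
  mul_le x y := by rw [map_mul]; exact hp.mul_le _ _
  star_mul_self x := by rw [map_mul, map_star]; exact hp.star_mul_self _

end IsCStarSeminorm

theorem isCStarSeminorm_norm (B : Type*) [CStarAlgebra B] :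
    IsCStarSeminorm (fun x : B => ‖x‖) where
  add_le := norm_add_le
  smul := norm_smul
  mul_le := norm_mul_le
  star_mul_self x := by rw [CStarRing.norm_star_mul_self, sq]

/-- A copy of the `*`-algebra `P`, to be topologized by the `C^*`-seminorm `p`. -/
def SeminormedCopy {P : Type*} [Ring P] [StarRing P] [Algebra ℂ P] {p : P → ℝ}
    (_ : IsCStarSeminorm p) : Type _ := P

section Completion

variable {P : Type*} [Ring P] [StarRing P] [Algebra ℂ P] [StarModule ℂ P] {p : P → ℝ}
  (hp : IsCStarSeminorm p)

instance SeminormedCopy.instRing : Ring (SeminormedCopy hp) := inferInstanceAs (Ring P)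

/-- The seminorm, as a seminorm of additive groups on the copy of `P`. -/
def SeminormedCopy.addGroupSeminorm : AddGroupSeminorm (SeminormedCopy hp) where
  toFun := p
  map_zero' := hp.zero
  add_le' := hp.add_le
  neg' := hp.neg

instance SeminormedCopy.instSeminormedRing : SeminormedRing (SeminormedCopy hp) :=
  { SeminormedCopy.instRing hp,
    (SeminormedCopy.addGroupSeminorm hp).toSeminormedAddCommGroup with
    norm_mul_le := hp.mul_le }

instance : StarRing (SeminormedCopy hp) := inferInstanceAs (StarRing P)

instance SeminormedCopy.instAlgebra : Algebra ℂ (SeminormedCopy hp) :=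
  inferInstanceAs (Algebra ℂ P)

instance : StarModule ℂ (SeminormedCopy hp) := inferInstanceAs (StarModule ℂ P)

theorem SeminormedCopy.norm_def (x : SeminormedCopy hp) : ‖x‖ = p x := rfl

instance SeminormedCopy.instNormedAlgebra : NormedAlgebra ℂ (SeminormedCopy hp) :=
  { SeminormedCopy.instAlgebra hp with
    norm_smul_le := fun c x => (hp.smul c x).le }

instance : NormedStarGroup (SeminormedCopy hp) where
  norm_star_le x := (hp.star_eq x).le

/-- The `C^*`-algebra obtained from a `*`-algebra by separation and completion with respect to a
`C^*`-seminorm. -/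
def CStarCompletion : Type _ := UniformSpace.Completion (SeminormedCopy hp)

namespace CStarCompletion

instance instNormedRing : NormedRing (CStarCompletion hp) :=
  inferInstanceAs (NormedRing (UniformSpace.Completion (SeminormedCopy hp)))

instance : CompleteSpace (CStarCompletion hp) :=
  inferInstanceAs (CompleteSpace (UniformSpace.Completion (SeminormedCopy hp)))

instance instAlgebra : Algebra ℂ (CStarCompletion hp) :=
  inferInstanceAs (Algebra ℂ (UniformSpace.Completion (SeminormedCopy hp)))

/-- The canonical map to the completion. -/
def coe (x : P) : CStarCompletion hp :=
  ((show SeminormedCopy hp from x : SeminormedCopy hp) :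
    UniformSpace.Completion (SeminormedCopy hp))

theorem coe_add (x y : P) : coe hp (x + y) = coe hp x + coe hp y :=
  UniformSpace.Completion.coe_add (α := SeminormedCopy hp) _ _

theorem coe_mul (x y : P) : coe hp (x * y) = coe hp x * coe hp y :=
  UniformSpace.Completion.coe_mul (α := SeminormedCopy hp) _ _

theorem coe_algebraMap (c : ℂ) :
    coe hp (algebraMap ℂ P c) = algebraMap ℂ (CStarCompletion hp) c := rfl

theorem norm_coe (x : P) : ‖coe hp x‖ = p x :=
  UniformSpace.Completion.norm_coe (E := SeminormedCopy hp) _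

theorem denseRange_coe : DenseRange (coe hp) :=
  UniformSpace.Completion.denseRange_coe (α := SeminormedCopy hp)

theorem induction {C : CStarCompletion hp → Prop} (a : CStarCompletion hp)
    (hC : IsClosed {a | C a}) (h : ∀ x : P, C (coe hp x)) : C a :=
  UniformSpace.Completion.induction_on (α := SeminormedCopy hp) a hC h

instance instStar : Star (CStarCompletion hp) where
  star := UniformSpace.Completion.map (star : SeminormedCopy hp → SeminormedCopy hp)

theorem continuous_star' : Continuous (star : CStarCompletion hp → CStarCompletion hp) :=
  UniformSpace.Completion.continuous_map

theorem coe_star (x : P) : coe hp (star x) = star (coe hp x) :=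
  (UniformSpace.Completion.map_coe (α := SeminormedCopy hp)
    (star_isometry (E := SeminormedCopy hp)).uniformContinuous _).symm

theorem smul_coe (c : ℂ) (x : P) : coe hp (c • x) = c • coe hp x := by
  rw [Algebra.smul_def, coe_mul, coe_algebraMap, Algebra.smul_def]

instance instStarRing : StarRing (CStarCompletion hp) where
  star_involutive a := by
    induction a using CStarCompletion.induction with
    | hC => exact isClosed_eq ((continuous_star' hp).comp (continuous_star' hp)) continuous_id
    | h x => rw [← coe_star, ← coe_star, star_star]
  star_mul a b := by
    have hs := continuous_star' hp
    induction a using CStarCompletion.induction with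
    | hC => exact isClosed_eq (hs.comp (by fun_prop)) (continuous_const.mul hs)
    | h x =>
      induction b using CStarCompletion.induction with
      | hC => exact isClosed_eq (hs.comp (by fun_prop)) (hs.mul continuous_const)
      | h y => rw [← coe_mul, ← coe_star, ← coe_star, ← coe_star, ← coe_mul, star_mul]
  star_add a b := by
    have hs := continuous_star' hp
    induction a using CStarCompletion.induction with
    | hC => exact isClosed_eq (hs.comp (by fun_prop)) (hs.add continuous_const)
    | h x =>
      induction b using CStarCompletion.induction with
      | hC => exact isClosed_eq (hs.comp (by fun_prop)) (continuous_const.add hs)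
      | h y => rw [← coe_add, ← coe_star, ← coe_star, ← coe_star, ← coe_add, star_add]

instance instNormedAlgebra : NormedAlgebra ℂ (CStarCompletion hp) :=
  { instAlgebra hp with
    norm_smul_le := fun c a =>
      norm_smul_le (α := ℂ) (β := UniformSpace.Completion (SeminormedCopy hp)) c a }

instance instStarModule : StarModule ℂ (CStarCompletion hp) where
  star_smul c a := by
    have hs := continuous_star' hp
    induction a using CStarCompletion.induction with
    | hC => exact isClosed_eq (hs.comp (continuous_const_smul c)) ((continuous_const_smul (star c)).comp hs)
    | h x => rw [← smul_coe, ← coe_star, ← coe_star, ← smul_coe, star_smul]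

instance instCStarRing : CStarRing (CStarCompletion hp) where
  norm_mul_self_le a := by
    have hs := continuous_star' hp
    induction a using CStarCompletion.induction with
    | hC =>
      exact isClosed_le (continuous_norm.mul continuous_norm)
        (continuous_norm.comp (hs.mul continuous_id))
    | h x => rw [← coe_star, ← coe_mul, norm_coe, norm_coe, hp.star_mul_self, sq]

instance instCStarAlgebra : CStarAlgebra (CStarCompletion hp) where

/-- The canonical `*`-homomorphism to the completion. -/
def of : P →⋆ₐ[ℂ] CStarCompletion hp where
  toFun := coe hp
  map_one' := rfl
  map_mul' := coe_mul hp
  map_zero' := rfl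
  map_add' := coe_add hp
  commutes' := coe_algebraMap hp
  map_star' := coe_star hp

theorem norm_of (x : P) : ‖of hp x‖ = p x := norm_coe hp x

variable {B : Type*} [CStarAlgebra B]

/-- Extension of a `*`-homomorphism dominated by the `C^*`-seminorm to the completion. -/
def lift (f : P →⋆ₐ[ℂ] B) (hf : ∀ x, ‖f x‖ ≤ p x) : CStarCompletion hp →⋆ₐ[ℂ] B :=
  let f' : SeminormedCopy hp →+* B := ((f : P →ₐ[ℂ] B) : P →+* B)
  have hc : Continuous f' :=
    AddMonoidHomClass.continuous_of_bound f' 1 (fun x => by rw [one_mul]; exact hf x)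
  let F : UniformSpace.Completion (SeminormedCopy hp) →+* B :=
    UniformSpace.Completion.extensionHom f' hc
  have hF : ∀ x : P, F (coe hp x) = f x := UniformSpace.Completion.extensionHom_coe f' hc
  have hFc : Continuous F := UniformSpace.Completion.continuous_extension
  { F with
    commutes' := fun c => by
      change F (coe hp (algebraMap ℂ P c)) = _
      rw [hF, AlgHomClass.commutes]
    map_star' := fun a => by
      change F (star a : CStarCompletion hp) = star (F a)
      induction a using CStarCompletion.induction with
      | hC => exact isClosed_eq (hFc.comp (continuous_star' hp)) (continuous_star.comp hFc)
      | h x => rw [← coe_star, hF, hF, map_star] }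

@[simp]
theorem lift_of (f : P →⋆ₐ[ℂ] B) (hf : ∀ x, ‖f x‖ ≤ p x) (x : P) :
    lift hp f hf (of hp x) = f x :=
  let f' : SeminormedCopy hp →+* B := ((f : P →ₐ[ℂ] B) : P →+* B)
  have hc : Continuous f' :=
    AddMonoidHomClass.continuous_of_bound f' 1 (fun x => by rw [one_mul]; exact hf x)
  UniformSpace.Completion.extensionHom_coe f' hc x

theorem hom_ext {φ ψ : CStarCompletion hp →⋆ₐ[ℂ] B}
    (h : ∀ x, φ (of hp x) = ψ (of hp x)) : φ = ψ := by
  have hcont : ∀ χ : CStarCompletion hp →⋆ₐ[ℂ] B, Continuous χ := fun χ =>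
    AddMonoidHomClass.continuous_of_bound χ 1
      (by simpa only [one_mul] using NonUnitalStarAlgHom.norm_apply_le χ)
  ext a
  induction a using CStarCompletion.induction with
  | hC => exact isClosed_eq (hcont φ) (hcont ψ)
  | h x => exact h x

end CStarCompletion

end Completion

/-! ## Universal `C^*`-algebras -/

section Universal

variable {P : Type*} [Ring P] [StarRing P] [Algebra ℂ P] [StarModule ℂ P]

/-- `p` is a `C^*`-seminorm that vanishes on the set `R` of relators, that is, a `C^*`-seminorm of
the `*`-algebra obtained from `P` by imposing `r = 0` for all `r ∈ R`. -/
def IsAdmissible (R : Set P) (p : P → ℝ) : Prop := IsCStarSeminorm p ∧ ∀ r ∈ R, p r = 0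

/-- The relators bound every `C^*`-seminorm, so that the universal `C^*`-algebra exists. -/
class BoundedRelators (R : Set P) : Prop where
  bound : ∀ x : P, ∃ C : ℝ, ∀ p : P → ℝ, IsAdmissible R p → p x ≤ C

/-- The largest `C^*`-seminorm that vanishes on the relators. -/
def maxCStarSeminorm (R : Set P) (x : P) : ℝ := ⨆ p : {p : P → ℝ // IsAdmissible R p}, p.1 x

variable (R : Set P) [BoundedRelators R]

theorem le_maxCStarSeminorm {p : P → ℝ} (hp : IsAdmissible R p) (x : P) :
    p x ≤ maxCStarSeminorm R x := by
  obtain ⟨C, hC⟩ := BoundedRelators.bound (R := R) x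
  exact le_ciSup (f := fun p : {p : P → ℝ // IsAdmissible R p} => p.1 x)
    ⟨C, by rintro _ ⟨p, rfl⟩; exact hC p.1 p.2⟩ ⟨p, hp⟩

theorem isAdmissible_maxCStarSeminorm : IsAdmissible R (maxCStarSeminorm R) := by
  have h0 : IsAdmissible R (fun _ => 0) :=
    ⟨⟨by simp, by simp, by simp, by simp⟩, by simp⟩
  have : Nonempty {p : P → ℝ // IsAdmissible R p} := ⟨⟨_, h0⟩⟩
  have hle := fun {p : P → ℝ} (hp : IsAdmissible R p) (x : P) => le_maxCStarSeminorm R hp x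
  have hnn : ∀ x, 0 ≤ maxCStarSeminorm R x := fun x => hle h0 x
  refine ⟨⟨fun x y => ciSup_le fun p => ?_, fun c x => ?_, fun x y => ciSup_le fun p => ?_,
    fun x => le_antisymm (ciSup_le fun p => ?_) ?_⟩, fun r hr => ?_⟩
  · exact (p.2.1.add_le x y).trans (add_le_add (hle p.2 x) (hle p.2 y))
  · unfold maxCStarSeminorm
    rw [Real.mul_iSup_of_nonneg (norm_nonneg c)]
    exact iSup_congr fun p => p.2.1.smul c x
  · exact (p.2.1.mul_le x y).trans
      (mul_le_mul (hle p.2 x) (hle p.2 y) (p.2.1.nonneg y) (hnn x))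
  · rw [p.2.1.star_mul_self]
    exact pow_le_pow_left₀ (p.2.1.nonneg x) (hle p.2 x) 2
  · have h1 : maxCStarSeminorm R x ≤ √(maxCStarSeminorm R (star x * x)) := ciSup_le fun p =>
      Real.le_sqrt_of_sq_le (by rw [← p.2.1.star_mul_self]; exact hle p.2 _)
    calc maxCStarSeminorm R x ^ 2 ≤ √(maxCStarSeminorm R (star x * x)) ^ 2 :=
          pow_le_pow_left₀ (hnn x) h1 2
      _ = _ := Real.sq_sqrt (hnn _)
  · exact le_antisymm (ciSup_le fun p => (p.2.2 r hr).le) (hnn r)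

/-- The universal `C^*`-algebra generated by the `*`-algebra `P` subject to the relations `r = 0`,
`r ∈ R`: the completion with respect to the largest `C^*`-seminorm. -/
abbrev UniversalCStarAlgebra : Type _ := CStarCompletion (isAdmissible_maxCStarSeminorm R).1

namespace UniversalCStarAlgebra

/-- The canonical `*`-homomorphism to the universal `C^*`-algebra. -/
def of : P →⋆ₐ[ℂ] UniversalCStarAlgebra R := CStarCompletion.of _

theorem of_eq_zero {r : P} (hr : r ∈ R) : of R r = 0 := by
  rw [← norm_eq_zero]
  exact (CStarCompletion.norm_of _ r).trans ((isAdmissible_maxCStarSeminorm R).2 r hr)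

variable {B : Type*} [CStarAlgebra B]

/-- The universal property. -/
def lift (f : P →⋆ₐ[ℂ] B) (hf : ∀ r ∈ R, f r = 0) : UniversalCStarAlgebra R →⋆ₐ[ℂ] B :=
  CStarCompletion.lift _ f
    (le_maxCStarSeminorm R ⟨(isCStarSeminorm_norm B).comp f, fun r hr => by simp [hf r hr]⟩)

@[simp]
theorem lift_of (f : P →⋆ₐ[ℂ] B) (hf : ∀ r ∈ R, f r = 0) (x : P) :
    lift R f hf (of R x) = f x :=
  CStarCompletion.lift_of _ _ _ x

theorem hom_ext {φ ψ : UniversalCStarAlgebra R →⋆ₐ[ℂ] B}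
    (h : ∀ x, φ (of R x) = ψ (of R x)) : φ = ψ :=
  CStarCompletion.hom_ext _ h

end UniversalCStarAlgebra

end Universal

open FreeStarAlgebra in
/-- If the relators make all generators isometries, the universal `C^*`-algebra exists. -/
theorem boundedRelators_of_isometries {X : Type*} (R : Set (FreeStarAlgebra X))
    (hR : ∀ x, star (gen x) * gen x - 1 ∈ R) : BoundedRelators R where
  bound a := by
    have hgen : ∀ p : FreeStarAlgebra X → ℝ, IsAdmissible R p → ∀ x, p (gen x) ≤ 1 := by
      intro p hp x
      have h1 : p (star (gen x) * gen x) ≤ 1 := by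
        have h2 := hp.1.add_le (star (gen x) * gen x - 1) 1
        rw [sub_add_cancel, hp.2 _ (hR x)] at h2
        linarith [hp.1.one_le]
      rw [hp.1.star_mul_self] at h1
      exact (sq_le_one_iff₀ (hp.1.nonneg _)).1 h1
    induction a using FreeStarAlgebra.induction with
    | scalar c => exact ⟨‖c‖, fun p hp => hp.1.algebraMap_le c⟩
    | letter y =>
      refine ⟨1, fun p hp => ?_⟩
      cases y with
      | inl x => exact hgen p hp x
      | inr x => rw [letter_inr, hp.1.star_eq]; exact hgen p hp x
    | mul a b ha hb =>
      obtain ⟨C, hC⟩ := ha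
      obtain ⟨D, hD⟩ := hb
      exact ⟨C * D, fun p hp => (hp.1.mul_le a b).trans
        (mul_le_mul (hC p hp) (hD p hp) (hp.1.nonneg b) ((hp.1.nonneg a).trans (hC p hp)))⟩
    | add a b ha hb =>
      obtain ⟨C, hC⟩ := ha
      obtain ⟨D, hD⟩ := hb
      exact ⟨C + D, fun p hp => (hp.1.add_le a b).trans (add_le_add (hC p hp) (hD p hp))⟩

/-! ## Cuntz-Toeplitz algebras and their `q`-twist -/

open FreeStarAlgebra in
/-- The relators `s_i^* s_j - δ_{ij} 1`. -/
def cuntzToeplitzRelators (n : ℕ) : Set (FreeStarAlgebra (Fin n)) :=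
  {r | ∃ i j, r = star (gen i) * gen j - if i = j then 1 else 0}

instance (n : ℕ) : BoundedRelators (cuntzToeplitzRelators n) :=
  boundedRelators_of_isometries _ fun i => ⟨i, i, by simp⟩

/-- The Cuntz-Toeplitz algebra `O_n^{(0)}`, the universal `C^*`-algebra generated by `n` isometries
with mutually orthogonal ranges. -/
abbrev CuntzToeplitz (n : ℕ) : Type := UniversalCStarAlgebra (cuntzToeplitzRelators n)

/-- The generating isometries of the Cuntz-Toeplitz algebra. -/
def CuntzToeplitz.gen {n : ℕ} (j : Fin n) : CuntzToeplitz n :=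
  UniversalCStarAlgebra.of _ (FreeStarAlgebra.gen j)

open FreeStarAlgebra in
/-- The relators `s_i^* s_j - δ_{ij} 1`, `t_r^* t_l - δ_{rl} 1` and `s_j^* t_r - q t_r s_j^*` in the
free `*`-algebra on `s_j` (`Sum.inl j`) and `t_r` (`Sum.inr r`). -/
def twistedRelators (n m : ℕ) (q : ℂ) : Set (FreeStarAlgebra (Fin n ⊕ Fin m)) :=
  {x | (∃ i j, x = star (gen (.inl i)) * gen (.inl j) - if i = j then 1 else 0) ∨
    (∃ r l, x = star (gen (.inr r)) * gen (.inr l) - if r = l then 1 else 0) ∨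
    (∃ j r, x = star (gen (.inl j)) * gen (.inr r) - q • (gen (.inr r) * star (gen (.inl j))))}

instance (n m : ℕ) (q : ℂ) : BoundedRelators (twistedRelators n m q) :=
  boundedRelators_of_isometries _ fun x => by
    cases x with
    | inl i => exact Or.inl ⟨i, i, by simp⟩
    | inr r => exact Or.inr (Or.inl ⟨r, r, by simp⟩)

/-- The `q`-twist `E_{n,m}^q` of the Cuntz-Toeplitz algebras `O_n^{(0)}` and `O_m^{(0)}`. -/
abbrev TwistedCuntzToeplitz (n m : ℕ) (q : ℂ) : Type :=
  UniversalCStarAlgebra (twistedRelators n m q)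

/-! ## Tensor products -/

section Tensor

variable {A B : Type*} [CStarAlgebra A] [CStarAlgebra B]

/-- `a ↦ a ⊗ 1` to the algebraic tensor product. -/
def inclLeft (A B : Type*) [CStarAlgebra A] [CStarAlgebra B] : A →⋆ₐ[ℂ] A ⊗[ℂ] B :=
  { (Algebra.TensorProduct.includeLeft : A →ₐ[ℂ] A ⊗[ℂ] B) with
    map_star' := fun a => by simp }

/-- `b ↦ 1 ⊗ b` to the algebraic tensor product. -/
def inclRight (A B : Type*) [CStarAlgebra A] [CStarAlgebra B] : B →⋆ₐ[ℂ] A ⊗[ℂ] B :=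
  { (Algebra.TensorProduct.includeRight : B →ₐ[ℂ] A ⊗[ℂ] B) with
    map_star' := fun b => by simp }

/-- A `C^*`-seminorm on a `C^*`-algebra is dominated by the norm. -/
theorem IsCStarSeminorm.le_norm {p : A → ℝ} (hp : IsCStarSeminorm p) (a : A) : p a ≤ ‖a‖ := by
  rw [← CStarCompletion.norm_of hp a]
  exact NonUnitalStarAlgHom.norm_apply_le (CStarCompletion.of hp) a

instance : BoundedRelators (∅ : Set (A ⊗[ℂ] B)) where
  bound x := by
    induction x using TensorProduct.induction_on with
    | zero => exact ⟨0, fun p hp => hp.1.zero.le⟩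
    | tmul a b =>
      refine ⟨‖a‖ * ‖b‖, fun p hp => ?_⟩
      have h : a ⊗ₜ[ℂ] b = inclLeft A B a * inclRight A B b := by
        change a ⊗ₜ[ℂ] b = (a ⊗ₜ[ℂ] (1 : B)) * ((1 : A) ⊗ₜ[ℂ] b)
        rw [Algebra.TensorProduct.tmul_mul_tmul, mul_one, one_mul]
      rw [h]
      exact (hp.1.mul_le _ _).trans (mul_le_mul ((hp.1.comp (inclLeft A B)).le_norm a)
        ((hp.1.comp (inclRight A B)).le_norm b) (hp.1.nonneg _) (norm_nonneg _))
    | add x y hx hy =>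
      obtain ⟨C, hC⟩ := hx
      obtain ⟨D, hD⟩ := hy
      exact ⟨C + D, fun p hp => (hp.1.add_le x y).trans (add_le_add (hC p hp) (hD p hp))⟩

/-- The `C^*`-tensor product: the completion of the algebraic tensor product with respect to its
largest `C^*`-seminorm. If one of the factors is nuclear, this is the only `C^*`-norm on the
algebraic tensor product. -/
abbrev CStarTensor (A B : Type*) [CStarAlgebra A] [CStarAlgebra B] : Type _ :=
  UniversalCStarAlgebra (∅ : Set (A ⊗[ℂ] B))

namespace CStarTensor

/-- The elementary tensor `a ⊗ b`. -/
def tmul (a : A) (b : B) : CStarTensor A B := UniversalCStarAlgebra.of _ (a ⊗ₜ[ℂ] b)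

theorem hom_ext {C : Type*} [CStarAlgebra C] {φ ψ : CStarTensor A B →⋆ₐ[ℂ] C}
    (h : ∀ a b, φ (tmul a b) = ψ (tmul a b)) : φ = ψ := by
  refine UniversalCStarAlgebra.hom_ext _ fun x => ?_
  induction x using TensorProduct.induction_on with
  | zero => simp
  | tmul a b => exact h a b
  | add x y hx hy => rw [map_add, map_add, map_add, hx, hy]

/-- The `*`-homomorphism `f ⊗ g` of algebraic tensor products. -/
def algMap (f : A →⋆ₐ[ℂ] A) (g : B →⋆ₐ[ℂ] B) : A ⊗[ℂ] B →⋆ₐ[ℂ] A ⊗[ℂ] B :=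
  { Algebra.TensorProduct.map (f : A →ₐ[ℂ] A) (g : B →ₐ[ℂ] B) with
    map_star' := fun x => by
      change Algebra.TensorProduct.map (f : A →ₐ[ℂ] A) (g : B →ₐ[ℂ] B) (star x)
        = star (Algebra.TensorProduct.map (f : A →ₐ[ℂ] A) (g : B →ₐ[ℂ] B) x)
      induction x using TensorProduct.induction_on with
      | zero => simp
      | tmul a b => simp [map_star]
      | add x y hx hy => rw [star_add, map_add, map_add, star_add, hx, hy] }

/-- The endomorphism `f ⊗ g` of the `C^*`-tensor product. -/
def map (f : A →⋆ₐ[ℂ] A) (g : B →⋆ₐ[ℂ] B) : CStarTensor A B →⋆ₐ[ℂ] CStarTensor A B :=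
  UniversalCStarAlgebra.lift _ ((UniversalCStarAlgebra.of _).comp (algMap f g)) (by simp)

@[simp]
theorem map_tmul (f : A →⋆ₐ[ℂ] A) (g : B →⋆ₐ[ℂ] B) (a : A) (b : B) :
    map f g (tmul a b) = tmul (f a) (g b) :=
  (UniversalCStarAlgebra.lift_of _ _ _ _).trans rfl

end CStarTensor

end Tensor

/-! ## Actions -/

section Actions

variable {G H : Type*} [Group G] [Group H] {A B : Type*} [CStarAlgebra A] [CStarAlgebra B]

/-- A multiplicative family of unital `*`-endomorphisms indexed by a group is an action by
`*`-automorphisms. -/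
def actionOfEndomorphisms (φ : G → (A →⋆ₐ[ℂ] A)) (h1 : φ 1 = StarAlgHom.id ℂ A)
    (hmul : ∀ g h, φ (g * h) = (φ g).comp (φ h)) : G →* (A ≃⋆ₐ[ℂ] A) where
  toFun g := StarAlgEquiv.ofStarAlgHom (φ g) (φ g⁻¹)
    (by rw [← hmul, inv_mul_cancel, h1]) (by rw [← hmul, mul_inv_cancel, h1])
  map_one' := by ext a; exact congrArg (fun ψ => ψ a) h1
  map_mul' g h := by ext a; exact congrArg (fun ψ => ψ a) (hmul g h)

/-- The action `α ⊗ β` of `G × H` on `A ⊗ B`, `(g, h) ↦ α_g ⊗ β_h`. -/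
def tensorAction (α : G →* (A ≃⋆ₐ[ℂ] A)) (β : H →* (B ≃⋆ₐ[ℂ] B)) :
    G × H →* (CStarTensor A B ≃⋆ₐ[ℂ] CStarTensor A B) :=
  actionOfEndomorphisms
    (fun g => CStarTensor.map (α g.1 : A →⋆ₐ[ℂ] A) (β g.2 : B →⋆ₐ[ℂ] B))
    (CStarTensor.hom_ext fun a b => by simp)
    (fun g h => CStarTensor.hom_ext fun a b => by simp)

end Actions

namespace CuntzToeplitz

variable {n : ℕ}

theorem relation (i j : Fin n) : star (gen i) * gen j = if i = j then 1 else 0 := by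
  have h := UniversalCStarAlgebra.of_eq_zero (cuntzToeplitzRelators n)
    (r := star (FreeStarAlgebra.gen i) * FreeStarAlgebra.gen j - if i = j then 1 else 0)
    ⟨i, j, rfl⟩
  rw [map_sub, map_mul, map_star, sub_eq_zero] at h
  refine h.trans ?_
  split_ifs <;> simp

theorem hom_ext {B : Type*} [CStarAlgebra B] {φ ψ : CuntzToeplitz n →⋆ₐ[ℂ] B}
    (h : ∀ j, φ (gen j) = ψ (gen j)) : φ = ψ := by
  refine UniversalCStarAlgebra.hom_ext _ fun x => ?_
  have h' : φ.comp (UniversalCStarAlgebra.of _) = ψ.comp (UniversalCStarAlgebra.of _) :=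
    FreeStarAlgebra.hom_ext h
  exact congrArg (fun χ => χ x) h'

/-- The endomorphism of the Cuntz-Toeplitz algebra with `s_j ↦ z s_j`. -/
def gaugeHom (n : ℕ) (z : Circle) : CuntzToeplitz n →⋆ₐ[ℂ] CuntzToeplitz n :=
  UniversalCStarAlgebra.lift _ (FreeStarAlgebra.lift fun j => (z : ℂ) • gen j) (by
    rintro _ ⟨i, j, rfl⟩
    have hz : star (z : ℂ) * (z : ℂ) = 1 := by
      simp [← Complex.normSq_eq_conj_mul_self]
    rw [map_sub, map_mul, map_star, FreeStarAlgebra.lift_gen, FreeStarAlgebra.lift_gen, star_smul,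
      smul_mul_smul_comm, hz, one_smul, relation]
    split_ifs <;> simp)

@[simp]
theorem gaugeHom_gen (z : Circle) (j : Fin n) : gaugeHom n z (gen j) = (z : ℂ) • gen j :=
  (UniversalCStarAlgebra.lift_of _ _ _ _).trans (FreeStarAlgebra.lift_gen _ _)

/-- The gauge action of the circle group on the Cuntz-Toeplitz algebra, `s_j ↦ z s_j`. -/
def gauge (n : ℕ) : Circle →* (CuntzToeplitz n ≃⋆ₐ[ℂ] CuntzToeplitz n) :=
  actionOfEndomorphisms (gaugeHom n) (hom_ext fun j => by simp)
    (fun z w => hom_ext fun j => by simp [mul_smul, smul_comm (z : ℂ)])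

end CuntzToeplitz

/-- The homomorphism `(x_1, x_2) ↦ (e^{2πi x_1}, e^{2πi x_2})` from `ℝ²` onto the torus. -/
def toTorus : Multiplicative (EuclideanSpace ℝ (Fin 2)) →* Circle × Circle where
  toFun x := (Real.fourierChar (x.toAdd 0), Real.fourierChar (x.toAdd 1))
  map_one' := by simp
  map_mul' x y := by simp [AddChar.map_add_eq_mul]

/-- The periodic action of `ℝ²` given by the gauge action of the torus on
`O_n^{(0)} ⊗ O_m^{(0)}`. -/
def gaugeAction (n m : ℕ) : Multiplicative (EuclideanSpace ℝ (Fin 2)) →*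
    (CStarTensor (CuntzToeplitz n) (CuntzToeplitz m) ≃⋆ₐ[ℂ]
      CStarTensor (CuntzToeplitz n) (CuntzToeplitz m)) :=
  (tensorAction (CuntzToeplitz.gauge n) (CuntzToeplitz.gauge m)).comp toTorus

/-! ## Rieffel deformation -/

section Rieffel

variable {d : ℕ} {A : Type*} [CStarAlgebra A]
  (α : Multiplicative (EuclideanSpace ℝ (Fin d)) →* (A ≃⋆ₐ[ℂ] A))

/-- The set `A_∞` of smooth vectors of the action: `x ↦ α_x(a)` is a `C^∞` map to `A`. -/
def smoothVectors : Set A :=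
  {a | ContDiff ℝ ∞ fun x : EuclideanSpace ℝ (Fin d) => α (Multiplicative.ofAdd x) a}

variable (Θ : Matrix (Fin d) (Fin d) ℝ)
  {H : Type*} [NormedAddCommGroup H] [InnerProductSpace ℂ H] [CompleteSpace H]
  (π : A →⋆ₐ[ℂ] (H →L[ℂ] H))

/-- Rieffel's left multiplication operator
`(L_a f)(x) = ∫∫ α_{x + Θ u}(a) f(x + v) e^{2πi ⟨u, v⟩} dv du`
on Schwartz functions `f` with values in a Hilbert space `H` on which `A` is represented by `π`.
As `f` is a Schwartz function, the inner integral over `v` is a Schwartz function of `u`, so the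
oscillatory integral is an iterated integral of integrable functions. -/
def rieffelLeftMul (a : A) (f : 𝓢(EuclideanSpace ℝ (Fin d), H)) (x : EuclideanSpace ℝ (Fin d)) :
    H :=
  ∫ u : EuclideanSpace ℝ (Fin d),
    π (α (Multiplicative.ofAdd (x + Matrix.toEuclideanLin Θ u)) a)
      (∫ v : EuclideanSpace ℝ (Fin d),
        Complex.exp (2 * Real.pi * Complex.I * (inner ℝ u v : ℝ)) • f (x + v))

/-- The bounded operators on `L²(ℝ^d, H)` that act on Schwartz functions as `L_a` for a smooth
vector `a`. -/
def rieffelOperators :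
    Set (Lp H 2 (volume : Measure (EuclideanSpace ℝ (Fin d))) →L[ℂ]
      Lp H 2 (volume : Measure (EuclideanSpace ℝ (Fin d)))) :=
  {T | ∃ a ∈ smoothVectors α, ∀ f : 𝓢(EuclideanSpace ℝ (Fin d), H),
    T (f.toLp 2) =ᵐ[volume] rieffelLeftMul α Θ π a f}

/-- The Rieffel deformation `A_Θ` of `A` along the action `α` of `ℝ^d`, for a skew-symmetric matrix
`Θ` and a faithful representation `π` of `A`. On `A_∞` the deformed product is
`a ·_Θ b = ∫∫ α_{Θ x}(a) α_y(b) e^{2πi ⟨x, y⟩} dx dy`, the involution is that of `A`, and the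
`C^*`-norm is the operator norm of `L_a`; as `a ↦ L_a` is a `*`-homomorphism for this product, the
completion of `A_∞` is the `C^*`-algebra generated by the operators `L_a`, `a ∈ A_∞`.
Up to isomorphism it does not depend on the faithful representation. -/
def RieffelDeformation :
    StarSubalgebra ℂ (Lp H 2 (volume : Measure (EuclideanSpace ℝ (Fin d))) →L[ℂ]
      Lp H 2 (volume : Measure (EuclideanSpace ℝ (Fin d)))) :=
  (StarAlgebra.adjoin ℂ (rieffelOperators α Θ π)).topologicalClosure

end Rieffel

/-- The skew-symmetric matrix with entries `± φ₀ / 2`. -/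
def thetaMatrix (φ₀ : ℝ) : Matrix (Fin 2) (Fin 2) ℝ := !![0, φ₀ / 2; -(φ₀ / 2), 0]

end

/-!
# The twisted tensor product of Cuntz-Toeplitz algebras as a Rieffel deformation

Write `E` for `TwistedCuntzToeplitz n m q`, `A` for the tensor product of the two Cuntz-Toeplitz
algebras and `Θ` for `thetaMatrix φ`, where `q = e^{2πiφ}`. For `p ∈ ℤ²` and a bounded operator `B`
on `H`, the operator `twist p B` on `L²(ℝ², H)` sends `f` to `x ↦ e^{2πi⟨p, x⟩} B f(x + Θ p)`: it is
a Weyl unitary times the amplification of `B`. The Weyl unitaries form a projective representation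
of `ℤ²` that commutes with the amplifications, so that the twists of homogeneous elements of `A`
multiply up to the phase `e^{2πi⟨p', Θ p⟩}` (`TwistSystem`, `lpTwistSystem`). The choice of `Θ`
makes `twist (1, 0) π(s_j ⊗ 1)` and `twist (0, 1) π(1 ⊗ s_r)` satisfy the relations of `E`, which
gives a representation `Φ` of `E` on `L²(ℝ², H)` (`TwistedCuntzToeplitz.exists_twist`). It is shown
that `Φ` is injective and that its range is the Rieffel deformation.

*Injectivity.* Translations of `L²(ℝ², H)` implement the gauge action of the torus on `E`, so the
kernel of `Φ` is gauge invariant, and it contains the homogeneous components `x_p` of each of its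
elements `x`. Any representation `ρ` of `E` can be twisted back, with `-φ` in place of `φ`: the
twisted images of the generators then commute and `*`-commute, because `s_j t_r = \bar q t_r s_j`
also holds in `E`, so by universality they come from a representation `Ψ` of `A`. If `a ∈ A` is the
counterpart of a homogeneous `y ∈ E`, then `‖ρ y‖ = ‖Ψ a‖ ≤ ‖a‖ = ‖Φ y‖`
(`TwistedCuntzToeplitz.norm_apply_coeff_le`). Hence all representations of `E` kill every `x_p`; by
the GNS construction `x_p = 0` for all `p`, and an element is determined by its Fourier coefficients
(`IsTorusAction.eq_zero_of_coeff_eq_zero`), so `x = 0`.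

*Range.* For `a` of degree `p` the oscillatory integral `L_a` collapses by Fourier inversion to
`twist p (π a)` (`rieffelLeftMul_of_mem_isotypic`). As the generators are homogeneous, the range of
`Φ` is contained in the Rieffel deformation. Conversely, the homogeneous components of a smooth
vector `a` are absolutely summable, since third derivatives bound `|p|³ ‖a_p‖`
(`summable_norm_coeff_of_smooth`); so `L_a = ∑ L_{a_p}` lies in the range of `Φ`, which is closed
(`rieffelOperators_subset_range`).
-/

noncomputable section

/-! ### Separation of points by GNS representations -/

section GNS

open scoped ComplexOrder ComplexStarModule

variable {A : Type*} [CStarAlgebra A]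

/-- The positive functionals separate points: `-x^*x` is strictly separated from the closed convex
cone of positive elements. -/
theorem exists_positiveLinearMap_star_mul_self_ne_zero [PartialOrder A] [StarOrderedRing A]
    {x : A} (hx : x ≠ 0) : ∃ f : A →ₚ[ℂ] ℂ, f (star x * x) ≠ 0 := by
  have hcl : IsClosed {a : A | 0 ≤ a} := CStarAlgebra.isClosed_nonneg
  have hconv : Convex ℝ {a : A | 0 ≤ a} := fun a ha b hb s t hs ht _ =>
    add_nonneg (smul_nonneg hs ha) (smul_nonneg ht hb)
  have hmem : -(star x * x) ∉ {a : A | 0 ≤ a} := fun h => hx <| by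
    have h1 : star x * x = 0 := le_antisymm (neg_nonneg.1 h) (star_mul_self_nonneg x)
    exact CStarRing.star_mul_self_eq_zero_iff x |>.1 h1
  obtain ⟨l, u, hl, hu⟩ := geometric_hahn_banach_closed_point hconv hcl hmem
  have hu0 : 0 < u := by simpa using hl 0 le_rfl
  -- a linear functional bounded above on a cone is nonpositive there
  have hneg : ∀ a : A, 0 ≤ a → l a ≤ 0 := by
    intro a ha
    by_contra! hpos
    have h1 := hl ((u / l a) • a) (smul_nonneg (div_pos hu0 hpos).le ha)
    rw [map_smul, smul_eq_mul, div_mul_cancel₀ _ hpos.ne'] at h1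
    exact lt_irrefl _ h1
  let g : A →ₗ[ℂ] ℂ :=
    { toFun := fun a => -(l (ℜ a : A) : ℂ) - Complex.I * (l (ℑ a : A) : ℂ)
      map_add' := fun a b => by
        simp only [map_add, AddSubgroup.coe_add, Complex.ofReal_add]
        ring
      map_smul' := fun c a => by
        simp only [realPart_smul, imaginaryPart_smul, AddSubgroup.coe_sub, AddSubgroup.coe_add,
          selfAdjoint.val_smul, map_sub, map_add, map_smul, smul_eq_mul, RingHom.id_apply]
        apply Complex.ext <;> simp <;> ring }
  have hg : ∀ a : A, 0 ≤ a → g a = ((-(l a) : ℝ) : ℂ) := by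
    intro a ha
    have hsa : IsSelfAdjoint a := IsSelfAdjoint.of_nonneg ha
    change -(l (ℜ a : A) : ℂ) - Complex.I * (l (ℑ a : A) : ℂ) = _
    rw [hsa.coe_realPart, hsa.imaginaryPart]
    simp
  refine ⟨PositiveLinearMap.mk₀ g fun a ha => ?_, ?_⟩
  · rw [hg a ha]
    exact_mod_cast neg_nonneg.2 (hneg a ha)
  · change g (star x * x) ≠ 0
    rw [hg _ (star_mul_self_nonneg x)]
    have : 0 < -(l (star x * x)) := by
      rw [← map_neg]; exact hu0.trans hu
    exact_mod_cast this.ne'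

/-- An element that vanishes in all Hilbert space representations is zero. -/
theorem eq_zero_of_forall_representation_eq_zero {A : Type} [CStarAlgebra A] {x : A}
    (h : ∀ (K : Type) [NormedAddCommGroup K] [InnerProductSpace ℂ K] [CompleteSpace K]
      (ρ : A →⋆ₐ[ℂ] (K →L[ℂ] K)), ρ x = 0) : x = 0 := by
  let _ : PartialOrder A := CStarAlgebra.spectralOrder A
  have _ : StarOrderedRing A := CStarAlgebra.spectralOrderedRing A
  by_contra hx
  obtain ⟨f, hf⟩ := exists_positiveLinearMap_star_mul_self_ne_zero hx
  apply hf
  have h1 := h f.GNS f.gnsStarAlgHom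
  have h2 : f.gnsNonUnitalStarAlgHom x (f.toPreGNS 1 : f.PreGNS) = 0 := by
    change f.gnsStarAlgHom x _ = 0
    rw [h1]; rfl
  rw [PositiveLinearMap.gnsNonUnitalStarAlgHom_apply_coe, ← norm_eq_zero,
    UniformSpace.Completion.norm_coe] at h2
  have h3 := f.preGNS_norm_sq (f.leftMulMapPreGNS x (f.toPreGNS 1))
  rw [h2] at h3
  simpa using h3.symm

end GNS

/-! ### Weyl operators on vector-valued square integrable functions -/

section Weyl

variable {d : ℕ} {H : Type*} [NormedAddCommGroup H] [InnerProductSpace ℂ H] [CompleteSpace H]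

/-- The Hilbert space `L²(ℝ^d, H)`. -/
local notation "L²(" d "," H ")" => Lp H 2 (volume : Measure (EuclideanSpace ℝ (Fin d)))

theorem memLp_modulation_translation (k y : EuclideanSpace ℝ (Fin d)) (f : L²(d, H)) :
    MemLp (fun x => Real.fourierChar (inner ℝ k x) • f (x + y)) 2
      (volume : Measure (EuclideanSpace ℝ (Fin d))) := by
  have h := (Lp.memLp f).comp_measurePreserving (measurePreserving_add_right volume y)
  refine h.of_le ?_ (by simp)
  have hc : Continuous fun x : EuclideanSpace ℝ (Fin d) => Real.fourierChar (inner ℝ k x) := by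
    fun_prop
  exact hc.aestronglyMeasurable.smul h.1

/-- The Weyl operator `f ↦ (x ↦ e^{2πi⟨k, x⟩} f(x + y))` on `L²(ℝ^d, H)`, as an isometry. -/
def weylIsometry (H : Type*) [NormedAddCommGroup H] [InnerProductSpace ℂ H] [CompleteSpace H]
    (k y : EuclideanSpace ℝ (Fin d)) : L²(d, H) →ₗᵢ[ℂ] L²(d, H) :=
  { toFun := fun f => (memLp_modulation_translation k y f).toLp _
    map_add' := fun f g => by
      rw [← MemLp.toLp_add]
      apply MemLp.toLp_congr
      filter_upwards [(measurePreserving_add_right volume y).quasiMeasurePreserving.ae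
        (Lp.coeFn_add f g)] with x hx
      rw [Pi.add_apply, hx, Pi.add_apply, smul_add]
    map_smul' := fun c f => by
      rw [RingHom.id_apply, ← MemLp.toLp_const_smul]
      apply MemLp.toLp_congr
      filter_upwards [(measurePreserving_add_right volume y).quasiMeasurePreserving.ae
        (Lp.coeFn_smul c f)] with x hx
      simp only [hx, Pi.smul_apply]
      rw [smul_comm]
    norm_map' := fun f => by
      change ‖(memLp_modulation_translation k y f).toLp _‖ = ‖f‖
      rw [Lp.norm_toLp, Lp.norm_def]
      congr 1
      rw [← eLpNorm_comp_measurePreserving (Lp.aestronglyMeasurable f)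
        (measurePreserving_add_right volume y)]
      exact eLpNorm_congr_norm_ae (by simp) }

/-- The Weyl operator as a bounded operator. -/
def weyl (H : Type*) [NormedAddCommGroup H] [InnerProductSpace ℂ H] [CompleteSpace H]
    (k y : EuclideanSpace ℝ (Fin d)) : L²(d, H) →L[ℂ] L²(d, H) :=
  (weylIsometry H k y).toContinuousLinearMap

theorem coeFn_weyl (k y : EuclideanSpace ℝ (Fin d)) (f : L²(d, H)) :
    weyl H k y f =ᵐ[volume] fun x => Real.fourierChar (inner ℝ k x) • f (x + y) :=
  MemLp.coeFn_toLp (memLp_modulation_translation k y f)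

theorem norm_weyl_apply (k y : EuclideanSpace ℝ (Fin d)) (f : L²(d, H)) :
    ‖weyl H k y f‖ = ‖f‖ :=
  (weylIsometry H k y).norm_map f

theorem weyl_zero : weyl H (0 : EuclideanSpace ℝ (Fin d)) 0 = 1 := by
  ext1 f
  apply Lp.ext
  filter_upwards [coeFn_weyl 0 0 f] with x hx
  simp [hx]

/-- The Weyl commutation relation. -/
theorem weyl_mul_weyl (k y k' y' : EuclideanSpace ℝ (Fin d)) :
    weyl H k y * weyl H k' y' =
      (Real.fourierChar (inner ℝ k' y) : ℂ) • weyl H (k + k') (y + y') := by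
  ext1 f
  apply Lp.ext
  rw [_root_.smul_apply]
  filter_upwards [coeFn_weyl k y (weyl H k' y' f), coeFn_weyl (k + k') (y + y') f,
    (measurePreserving_add_right volume y).quasiMeasurePreserving.ae (coeFn_weyl k' y' f),
    Lp.coeFn_smul (Real.fourierChar (inner ℝ k' y) : ℂ) (weyl H (k + k') (y + y') f)]
    with x h1 h2 h3 h4
  rw [mul_apply_eq_comp, h1, h3, h4, Pi.smul_apply, h2, ← Circle.smul_def, smul_smul,
    smul_smul, ← AddChar.map_add_eq_mul, ← AddChar.map_add_eq_mul, inner_add_left,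
    inner_add_right]
  congr 2
  · ring
  · rw [add_assoc]

theorem star_weyl_mul_weyl (k y : EuclideanSpace ℝ (Fin d)) :
    star (weyl H k y) * weyl H k y = 1 :=
  (ContinuousLinearMap.norm_map_iff_adjoint_comp_self (weyl H k y)).1 (norm_weyl_apply k y)

theorem star_weyl (k y : EuclideanSpace ℝ (Fin d)) :
    star (weyl H k y) = (Real.fourierChar (inner ℝ k y) : ℂ) • weyl H (-k) (-y) := by
  have h : weyl H k y * ((Real.fourierChar (inner ℝ k y) : ℂ) • weyl H (-k) (-y)) = 1 := by
    rw [mul_smul_comm, weyl_mul_weyl, smul_smul, add_neg_cancel, add_neg_cancel, weyl_zero,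
      inner_neg_left, ← Circle.coe_mul, ← AddChar.map_add_eq_mul]
    simp
  calc star (weyl H k y)
      = star (weyl H k y) * (weyl H k y *
          ((Real.fourierChar (inner ℝ k y) : ℂ) • weyl H (-k) (-y))) := by rw [h, mul_one]
    _ = _ := by rw [← mul_assoc, star_weyl_mul_weyl, one_mul]

variable (d) in
/-- The amplification of a bounded operator on `H`, acting pointwise on `L²(ℝ^d, H)`. -/
def amplify (H : Type*) [NormedAddCommGroup H] [InnerProductSpace ℂ H] [CompleteSpace H] :
    (H →L[ℂ] H) →⋆ₐ[ℂ] (L²(d, H) →L[ℂ] L²(d, H)) :=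
  let F : (H →L[ℂ] H) → (L²(d, H) →L[ℂ] L²(d, H)) := fun B => B.compLpL 2 volume
  have hone : F 1 = 1 := by
    ext1 f
    apply Lp.ext
    filter_upwards [ContinuousLinearMap.coeFn_compLpL (1 : H →L[ℂ] H) f] with x hx
    exact hx
  have hsmul : ∀ (c : ℂ) B, F (c • B) = c • F B := fun c B =>
    ContinuousLinearMap.smul_compLpL c B
  have hadd : ∀ B C, F (B + C) = F B + F C := fun B C => ContinuousLinearMap.add_compLpL B C
  { toFun := F
    map_one' := hone
    map_mul' := fun B C => by
      ext1 f
      apply Lp.ext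
      filter_upwards [ContinuousLinearMap.coeFn_compLpL (B * C) f,
        ContinuousLinearMap.coeFn_compLpL B (C.compLpL 2 volume f),
        ContinuousLinearMap.coeFn_compLpL C f] with x h1 h2 h3
      change ((B * C).compLpL 2 volume f) x = (B.compLpL 2 volume (C.compLpL 2 volume f)) x
      rw [h1, h2, h3]
      rfl
    map_zero' := by simpa using hsmul 0 0
    map_add' := hadd
    commutes' := fun c => by
      rw [Algebra.algebraMap_eq_smul_one, hsmul, hone, Algebra.algebraMap_eq_smul_one]
    map_star' := fun B => by
      rw [ContinuousLinearMap.star_eq_adjoint, ContinuousLinearMap.star_eq_adjoint,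
        ContinuousLinearMap.eq_adjoint_iff]
      intro f g
      rw [L2.inner_def, L2.inner_def]
      apply integral_congr_ae
      filter_upwards [ContinuousLinearMap.coeFn_compLpL B g,
        ContinuousLinearMap.coeFn_compLpL (ContinuousLinearMap.adjoint B) f] with x h1 h2
      change inner ℂ ((ContinuousLinearMap.adjoint B).compLpL 2 volume f x) (g x)
        = inner ℂ (f x) (B.compLpL 2 volume g x)
      rw [h1, h2, ContinuousLinearMap.adjoint_inner_left] }

theorem coeFn_amplify (B : H →L[ℂ] H) (f : L²(d, H)) :
    amplify d H B f =ᵐ[volume] fun x => B (f x) :=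
  ContinuousLinearMap.coeFn_compLpL B f

theorem amplify_injective : Function.Injective (amplify d H) := by
  rw [injective_iff_map_eq_zero]
  intro B hB
  ext h
  have hs : MeasurableSet (Metric.ball (0 : EuclideanSpace ℝ (Fin d)) 1) := measurableSet_ball
  have hμ : volume (Metric.ball (0 : EuclideanSpace ℝ (Fin d)) 1) ≠ ⊤ := measure_ball_lt_top.ne
  have h0 : amplify d H B (indicatorConstLp 2 hs hμ h) = 0 := by rw [hB]; rfl
  have hae : ∀ᵐ x : EuclideanSpace ℝ (Fin d), x ∈ Metric.ball 0 1 → B h = 0 := by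
    filter_upwards [coeFn_amplify B (indicatorConstLp 2 hs hμ h), Lp.coeFn_zero H 2 volume,
      indicatorConstLp_coeFn (p := 2) (hs := hs) (hμs := hμ) (c := h)] with x h1 h2 h3 hx
    rw [h0, h2, h3, Set.indicator_of_mem hx] at h1
    exact h1.symm
  by_contra hne
  have hz : volume (Metric.ball (0 : EuclideanSpace ℝ (Fin d)) 1) = 0 := by
    refine measure_mono_null (fun x hx => ?_) hae
    exact fun h => hne (h hx)
  exact (Metric.measure_ball_pos volume _ one_pos).ne' hz

theorem commute_amplify_weyl (B : H →L[ℂ] H) (k y : EuclideanSpace ℝ (Fin d)) :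
    Commute (amplify d H B) (weyl H k y) := by
  ext1 f
  apply Lp.ext
  filter_upwards [coeFn_amplify B (weyl H k y f), coeFn_weyl k y f,
    coeFn_weyl k y (amplify d H B f),
    (measurePreserving_add_right volume y).quasiMeasurePreserving.ae (coeFn_amplify B f)]
    with x h1 h2 h3 h4
  rw [mul_apply_eq_comp, mul_apply_eq_comp, h1, h2, h3, h4,
    Circle.smul_def, Circle.smul_def, map_smul]

end Weyl

/-! ### Generators of universal algebras and of tensor products -/

section Generation

theorem StarAlgHom.continuous_of_cstar {A B : Type*} [CStarAlgebra A] [CStarAlgebra B]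
    (φ : A →⋆ₐ[ℂ] B) : Continuous φ :=
  AddMonoidHomClass.continuous_of_bound φ 1
    (by simpa only [one_mul] using NonUnitalStarAlgHom.norm_apply_le φ)

theorem UniversalCStarAlgebra.eq_top_of_gen_mem {X : Type*} (R : Set (FreeStarAlgebra X))
    [BoundedRelators R] (S : StarSubalgebra ℂ (UniversalCStarAlgebra R))
    (hS : IsClosed (S : Set (UniversalCStarAlgebra R)))
    (h : ∀ x, UniversalCStarAlgebra.of R (FreeStarAlgebra.gen x) ∈ S) : S = ⊤ := by
  refine eq_top_iff.2 fun a ha => ?_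
  clear ha
  induction a using CStarCompletion.induction with
  | hC => exact hS
  | h w =>
    change UniversalCStarAlgebra.of R w ∈ S
    induction w using FreeStarAlgebra.induction with
    | scalar r => rw [AlgHomClass.commutes]; exact S.algebraMap_mem r
    | letter y =>
      cases y with
      | inl x => exact h x
      | inr x => rw [FreeStarAlgebra.letter_inr, map_star]; exact star_mem (h x)
    | mul a b ha hb => rw [map_mul]; exact mul_mem ha hb
    | add a b ha hb => rw [map_add]; exact add_mem ha hb

namespace CStarTensor

variable {A B : Type*} [CStarAlgebra A] [CStarAlgebra B]

/-- The `*`-homomorphism `a ↦ a ⊗ 1`. -/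
def inl (A B : Type*) [CStarAlgebra A] [CStarAlgebra B] : A →⋆ₐ[ℂ] CStarTensor A B :=
  (UniversalCStarAlgebra.of _).comp (inclLeft A B)

/-- The `*`-homomorphism `b ↦ 1 ⊗ b`. -/
def inr (A B : Type*) [CStarAlgebra A] [CStarAlgebra B] : B →⋆ₐ[ℂ] CStarTensor A B :=
  (UniversalCStarAlgebra.of _).comp (inclRight A B)

theorem inl_apply (a : A) : inl A B a = tmul a 1 := rfl

theorem inr_apply (b : B) : inr A B b = tmul 1 b := rfl

theorem inl_mul_inr (a : A) (b : B) : inl A B a * inr A B b = tmul a b := by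
  rw [inl_apply, inr_apply, tmul, tmul, tmul, ← map_mul, Algebra.TensorProduct.tmul_mul_tmul,
    mul_one, one_mul]

theorem commute_inl_inr (a : A) (b : B) : Commute (inl A B a) (inr A B b) := by
  rw [commute_iff_eq, inl_mul_inr, inl_apply, inr_apply, tmul, tmul, tmul, ← map_mul,
    Algebra.TensorProduct.tmul_mul_tmul, mul_one, one_mul]

theorem eq_top_of_mem (S : StarSubalgebra ℂ (CStarTensor A B))
    (hS : IsClosed (S : Set (CStarTensor A B))) (hl : ∀ a, inl A B a ∈ S)
    (hr : ∀ b, inr A B b ∈ S) : S = ⊤ := by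
  refine eq_top_iff.2 fun x hx => ?_
  clear hx
  induction x using CStarCompletion.induction with
  | hC => exact hS
  | h w =>
    change UniversalCStarAlgebra.of _ w ∈ S
    induction w using TensorProduct.induction_on with
    | zero => rw [map_zero]; exact zero_mem S
    | tmul a b =>
      change tmul a b ∈ S
      rw [← inl_mul_inr]
      exact mul_mem (hl a) (hr b)
    | add x y hx hy => rw [map_add]; exact add_mem hx hy

/-- The universal property of the maximal tensor product: `*`-homomorphisms with commuting ranges
have a common extension. -/
theorem exists_hom_of_commute {C : Type*} [CStarAlgebra C] (f : A →⋆ₐ[ℂ] C) (g : B →⋆ₐ[ℂ] C)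
    (hfg : ∀ a b, Commute (f a) (g b)) :
    ∃ F : CStarTensor A B →⋆ₐ[ℂ] C, (∀ a, F (inl A B a) = f a) ∧ ∀ b, F (inr A B b) = g b := by
  let F₀ : A ⊗[ℂ] B →ₐ[ℂ] C := Algebra.TensorProduct.lift (f : A →ₐ[ℂ] C) (g : B →ₐ[ℂ] C) hfg
  have hF₀ : ∀ a b, F₀ (a ⊗ₜ b) = f a * g b := fun a b =>
    Algebra.TensorProduct.lift_tmul _ _ _ _ _
  let F₁ : A ⊗[ℂ] B →⋆ₐ[ℂ] C :=
    { F₀ with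
      map_star' := fun x => by
        change F₀ (star x) = star (F₀ x)
        induction x using TensorProduct.induction_on with
        | zero => simp
        | tmul a b =>
          rw [TensorProduct.star_tmul, hF₀, hF₀, star_mul, map_star, map_star]
          exact (hfg a b).star_star
        | add x y hx hy => rw [star_add, map_add, map_add, star_add, hx, hy] }
  refine ⟨UniversalCStarAlgebra.lift _ F₁ (by simp), fun a => ?_, fun b => ?_⟩
  · refine (UniversalCStarAlgebra.lift_of _ _ _ _).trans ?_
    exact (hF₀ a 1).trans (by rw [map_one, mul_one])
  · refine (UniversalCStarAlgebra.lift_of _ _ _ _).trans ?_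
    exact (hF₀ 1 b).trans (by rw [map_one, one_mul])

end CStarTensor

end Generation

/-! ### Fourier analysis of torus actions -/

section TorusAction

open UnitAddTorus

variable {d : Type*} [Fintype d] {B : Type*} [CStarAlgebra B]

/-- A strongly continuous action of the torus `(ℝ/ℤ)^d` by unital `*`-endomorphisms (hence by
`*`-automorphisms). -/
structure IsTorusAction (β : UnitAddTorus d → (B →⋆ₐ[ℂ] B)) : Prop where
  zero_eq : β 0 = StarAlgHom.id ℂ B
  add_eq : ∀ z w, β (z + w) = (β z).comp (β w)
  continuous_orbit : ∀ a, Continuous fun z => β z a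

/-- Strong continuity has to be checked on generators only. -/
theorem continuous_orbit_of_generators {T : Type*} [TopologicalSpace T] {β : T → (B →⋆ₐ[ℂ] B)}
    {s : Set B}
    (hgen : ∀ S : StarSubalgebra ℂ B, IsClosed (S : Set B) → s ⊆ S → S = ⊤)
    (hs : ∀ a ∈ s, Continuous fun z => β z a) (a : B) : Continuous fun z => β z a := by
  let S : StarSubalgebra ℂ B :=
    { carrier := {a | Continuous fun z => β z a}
      mul_mem' := fun {a b} ha hb => by
        simp only [Set.mem_ofPred_eq, map_mul] at *
        exact ha.mul hb
      add_mem' := fun {a b} ha hb => by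
        simp only [Set.mem_ofPred_eq, map_add] at *
        exact ha.add hb
      algebraMap_mem' := fun c => by
        simpa only [Set.mem_ofPred_eq, AlgHomClass.commutes] using continuous_const
      star_mem' := fun {a} ha => by
        simpa only [Set.mem_ofPred_eq, map_star] using Continuous.star ha }
  have hS : IsClosed (S : Set B) := by
    refine isClosed_of_closure_subset fun a ha => ?_
    refine continuous_of_uniform_approx_of_continuous fun u hu => ?_
    obtain ⟨ε, hε, hu⟩ := Metric.mem_uniformity_dist.1 hu
    obtain ⟨b, hb, hab⟩ := Metric.mem_closure_iff.1 ha ε hε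
    refine ⟨fun z => β z b, hb, fun z => hu ?_⟩
    rw [dist_eq_norm, ← map_sub]
    exact (NonUnitalStarAlgHom.norm_apply_le (β z) _).trans_lt (by rwa [← dist_eq_norm])
  have h : a ∈ S := by rw [hgen S hS hs]; trivial
  exact h

/-- The elements of degree `p`, on which the torus acts through the character `p`. -/
def isotypic (β : UnitAddTorus d → (B →⋆ₐ[ℂ] B)) (p : d → ℤ) : Submodule ℂ B where
  carrier := {a | ∀ z, β z a = mFourier p z • a}
  add_mem' := fun {a b} ha hb z => by rw [map_add, ha z, hb z, smul_add]
  zero_mem' := fun z => by simp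
  smul_mem' := fun c a ha z => by rw [map_smul, ha z, smul_comm]

theorem mem_isotypic {β : UnitAddTorus d → (B →⋆ₐ[ℂ] B)} {p : d → ℤ} {a : B} :
    a ∈ isotypic β p ↔ ∀ z, β z a = mFourier p z • a := Iff.rfl

theorem isClosed_isotypic (β : UnitAddTorus d → (B →⋆ₐ[ℂ] B)) (p : d → ℤ) :
    IsClosed (isotypic β p : Set B) := by
  have h : (isotypic β p : Set B) = ⋂ z, {a | β z a = mFourier p z • a} := by
    ext a; simp [mem_isotypic]
  rw [h]
  exact isClosed_iInter fun z =>
    isClosed_eq (β z).continuous_of_cstar (continuous_const_smul _)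

/-- The normalized Haar measure of the torus. -/
def torusHaar (d : Type*) [Fintype d] : Measure (UnitAddTorus d) :=
  Measure.pi fun _ => AddCircle.haarAddCircle

instance : IsProbabilityMeasure (torusHaar d) :=
  inferInstanceAs (IsProbabilityMeasure (Measure.pi fun _ : d => AddCircle.haarAddCircle))

instance : (torusHaar d).IsAddRightInvariant :=
  inferInstanceAs (Measure.pi fun _ : d => AddCircle.haarAddCircle).IsAddRightInvariant

theorem mFourierCoeff_eq {E : Type*} [NormedAddCommGroup E] [NormedSpace ℂ E]
    (f : UnitAddTorus d → E) (p : d → ℤ) :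
    mFourierCoeff f p = ∫ z, mFourier (-p) z • f z ∂torusHaar d := rfl

theorem norm_mFourier_apply (p : d → ℤ) (z : UnitAddTorus d) : ‖mFourier p z‖ = 1 := by
  change ‖∏ i, fourier (p i) (z i)‖ = 1
  rw [norm_prod]
  exact Finset.prod_eq_one fun _ _ => Circle.norm_coe _

theorem mFourier_apply_add (p : d → ℤ) (z w : UnitAddTorus d) :
    mFourier p (z + w) = mFourier p z * mFourier p w := by
  simp [mFourier, fourier_apply, smul_add, AddCircle.toCircle_add, Finset.prod_mul_distrib]

theorem continuous_integrable_torusHaar {E : Type*} [NormedAddCommGroup E]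
    {f : UnitAddTorus d → E} (hf : Continuous f) : Integrable f (torusHaar d) :=
  hf.integrable_of_hasCompactSupport (HasCompactSupport.of_compactSpace f)

theorem integral_mFourier [DecidableEq d] (p : d → ℤ) :
    ∫ z, mFourier p z ∂torusHaar d = if p = 0 then 1 else 0 := by
  split_ifs with hp
  · simp [hp, mFourier_zero]
  · obtain ⟨i, hi⟩ := Function.ne_iff.1 hp
    -- translation by a point where the character is `-1`
    let w : UnitAddTorus d := Pi.single i ((1 / 2 / (p i : ℝ) : ℝ) : UnitAddCircle)
    have hw : mFourier p w = -1 := by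
      have h1 : fourier (p i) (w i) = -1 := by
        have h2 := fourier_add_half_inv_index (T := 1) hi one_pos 0
        rw [zero_add, fourier_eval_zero] at h2
        simpa [w] using h2
      rw [← h1]
      change ∏ j, fourier (p j) (w j) = _
      refine Finset.prod_eq_single i (fun j _ hj => ?_) (by simp)
      simp [w, Pi.single_eq_of_ne hj]
    have h := integral_add_right_eq_self (μ := torusHaar d) (fun z => mFourier p z) w
    have hm : ∀ z, mFourier p (z + w) = -mFourier p z := fun z => by
      rw [mFourier_apply_add, hw, mul_neg_one]
    simp only [hm] at h
    rw [integral_neg] at h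
    exact self_eq_neg.1 h.symm

namespace IsTorusAction

variable {β : UnitAddTorus d → (B →⋆ₐ[ℂ] B)} (hβ : IsTorusAction β)
include hβ

theorem continuous_integrand (p : d → ℤ) (a : B) :
    Continuous fun z => mFourier p z • β z a :=
  (map_continuous _).smul (hβ.continuous_orbit a)

/-- The projection onto the elements of degree `p`,
`a ↦ ∫ e^{-2πi⟨p, z⟩} β_z(a) dz`. -/
def coeff (p : d → ℤ) : B →L[ℂ] B :=
  LinearMap.mkContinuous
    { toFun := fun a => mFourierCoeff (fun z => β z a) p
      map_add' := fun a b => by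
        rw [mFourierCoeff_eq, mFourierCoeff_eq, mFourierCoeff_eq, ← integral_add
          (continuous_integrable_torusHaar (hβ.continuous_integrand _ a))
          (continuous_integrable_torusHaar (hβ.continuous_integrand _ b))]
        simp only [map_add, smul_add]
      map_smul' := fun c a => by
        rw [mFourierCoeff_eq, mFourierCoeff_eq, RingHom.id_apply, ← integral_smul]
        simp only [map_smul, smul_comm c] }
    1 fun a => by
      change ‖mFourierCoeff (fun z => β z a) p‖ ≤ _
      rw [mFourierCoeff_eq, one_mul]
      refine (norm_integral_le_of_norm_le_const (C := ‖a‖) (.of_forall fun z => ?_)).trans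
        (by simp)
      rw [norm_smul, norm_mFourier_apply, one_mul]
      exact NonUnitalStarAlgHom.norm_apply_le (β z) a

theorem coeff_apply (p : d → ℤ) (a : B) :
    hβ.coeff p a = ∫ z, mFourier (-p) z • β z a ∂torusHaar d := rfl

theorem norm_coeff_apply_le (p : d → ℤ) (a : B) : ‖hβ.coeff p a‖ ≤ ‖a‖ := by
  simpa using (hβ.coeff p).le_of_opNorm_le (LinearMap.mkContinuous_norm_le _ zero_le_one _) a

theorem coeff_of_mem_isotypic [DecidableEq d] {p q : d → ℤ} {a : B} (ha : a ∈ isotypic β q) :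
    hβ.coeff p a = if p = q then a else 0 := by
  rw [coeff_apply]
  simp only [mem_isotypic.1 ha, smul_smul, ← mFourier_add]
  rw [integral_smul_const, integral_mFourier]
  simp only [neg_add_eq_zero]
  split_ifs <;> simp

/-- The coefficient map intertwines the action with the character `p`. -/
theorem coeff_action (p : d → ℤ) (w : UnitAddTorus d) (a : B) :
    hβ.coeff p (β w a) = mFourier p w • hβ.coeff p a := by
  rw [coeff_apply, coeff_apply, ← integral_smul,
    ← integral_add_right_eq_self (μ := torusHaar d) (fun z => _ • _ • β z a) w]
  congr 1
  ext z
  have h : mFourier p w * mFourier (-p) w = 1 := by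
    rw [← mFourier_add, add_neg_cancel, mFourier_zero]; rfl
  rw [hβ.add_eq, smul_smul, mFourier_apply_add, mul_left_comm, h, mul_one]
  rfl

/-- An element is determined by its Fourier coefficients. -/
theorem eq_zero_of_coeff_eq_zero {a : B} (h : ∀ p, hβ.coeff p a = 0) : a = 0 := by
  by_contra ha
  obtain ⟨l, -, hl⟩ := exists_dual_vector ℂ a (norm_ne_zero_iff.2 ha)
  let f : C(UnitAddTorus d, ℂ) := ⟨fun z => l (β z a), l.continuous.comp (hβ.continuous_orbit a)⟩
  have hf : ∀ p, mFourierCoeff f p = 0 := fun p => by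
    rw [mFourierCoeff_eq]
    have h1 := l.integral_comp_comm
      (continuous_integrable_torusHaar (hβ.continuous_integrand (-p) a))
    rw [← hβ.coeff_apply, h p, map_zero] at h1
    simp only [map_smul] at h1
    exact h1
  have h2 : Summable (mFourierCoeff f) := by
    rw [show mFourierCoeff f = fun _ => 0 from funext hf]; exact summable_zero
  have h3 := hasSum_mFourier_series_apply_of_summable h2 0
  simp only [hf, zero_smul] at h3
  have h4 : f 0 = 0 := h3.unique hasSum_zero
  change l (β 0 a) = 0 at h4
  rw [hβ.zero_eq] at h4
  change l a = 0 at h4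
  rw [hl] at h4
  exact ha (by simpa using h4)

/-- A dense graded subspace determines the homogeneous components up to closure. -/
theorem coeff_mem_closure (G : (d → ℤ) → Submodule ℂ B) (hG : ∀ p, G p ≤ isotypic β p)
    (h1 : 1 ∈ G 0) (hmul : ∀ p q, ∀ a ∈ G p, ∀ b ∈ G q, a * b ∈ G (p + q))
    (hstar : ∀ p, ∀ a ∈ G p, star a ∈ G (-p)) {s : Set B} (hsG : ∀ a ∈ s, ∃ p, a ∈ G p)
    (hgen : ∀ S : StarSubalgebra ℂ B, IsClosed (S : Set B) → s ⊆ S → S = ⊤) (p : d → ℤ) (a : B) :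
    hβ.coeff p a ∈ closure (G p : Set B) := by
  classical
  let S : StarSubalgebra ℂ B :=
    { carrier := (⨆ p, G p : Submodule ℂ B)
      mul_mem' := fun {a b} ha hb => by
        refine Submodule.iSup_induction G (motive := fun a => a * b ∈ (⨆ p, G p : Submodule ℂ B))
          ha (fun p a ha => ?_) (by simp) (fun x y hx hy => by rw [add_mul]; exact add_mem hx hy)
        refine Submodule.iSup_induction G (motive := fun b => a * b ∈ (⨆ p, G p : Submodule ℂ B))
          hb (fun q b hb => ?_) (by simp) (fun x y hx hy => by rw [mul_add]; exact add_mem hx hy)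
        exact Submodule.mem_iSup_of_mem (p + q) (hmul p q a ha b hb)
      add_mem' := fun {a b} ha hb => Submodule.add_mem _ ha hb
      algebraMap_mem' := fun c => by
        change algebraMap ℂ B c ∈ (⨆ p, G p : Submodule ℂ B)
        rw [Algebra.algebraMap_eq_smul_one]
        exact Submodule.smul_mem _ c (Submodule.mem_iSup_of_mem 0 h1)
      star_mem' := fun {a} ha => by
        refine Submodule.iSup_induction G (motive := fun a => star a ∈ (⨆ p, G p : Submodule ℂ B))
          ha (fun p a ha => ?_) (by simp) (fun x y hx hy => by rw [star_add]; exact add_mem hx hy)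
        exact Submodule.mem_iSup_of_mem (-p) (hstar p a ha) }
  have hS : S.topologicalClosure = ⊤ :=
    hgen _ S.isClosed_topologicalClosure fun x hx => by
      obtain ⟨q, hq⟩ := hsG x hx
      exact S.le_topologicalClosure (Submodule.mem_iSup_of_mem q hq)
  have ha : a ∈ closure (S : Set B) := by
    have : a ∈ S.topologicalClosure := by rw [hS]; trivial
    rwa [← SetLike.mem_coe, StarSubalgebra.topologicalClosure_coe] at this
  refine map_mem_closure (hβ.coeff p).continuous ha fun b hb => ?_
  refine Submodule.iSup_induction G (motive := fun b => hβ.coeff p b ∈ G p)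
    hb (fun q b hb => ?_) (by simp) (fun x y hx hy => by rw [map_add]; exact add_mem hx hy)
  rw [hβ.coeff_of_mem_isotypic (hG q hb)]
  split_ifs with hpq
  · rwa [hpq]
  · exact zero_mem _

theorem hasSum_coeff {a : B} (hiso : ∀ p, hβ.coeff p a ∈ isotypic β p)
    (ha : Summable fun p => ‖hβ.coeff p a‖) : HasSum (fun p => hβ.coeff p a) a := by
  classical
  have hs : HasSum (fun p => hβ.coeff p a) (∑' p, hβ.coeff p a) := ha.of_norm.hasSum
  have h : a - ∑' p, hβ.coeff p a = 0 := hβ.eq_zero_of_coeff_eq_zero fun q => by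
    have h1 := (hβ.coeff q).hasSum hs
    have h2 : (fun p => hβ.coeff q (hβ.coeff p a)) =
        fun p => if p = q then hβ.coeff q a else 0 := by
      ext p
      rw [hβ.coeff_of_mem_isotypic (hiso p)]
      by_cases hpq : p = q
      · simp [hpq]
      · rw [if_neg hpq, if_neg (Ne.symm hpq)]
    rw [h2] at h1
    rw [map_sub, sub_eq_zero]
    exact (hasSum_ite_eq q _).unique h1
  rw [sub_eq_zero] at h
  rwa [← h] at hs

end IsTorusAction

end TorusAction

/-! ### Twisting a `C^*`-algebra by a projective representation of `ℤ²` -/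

section Twist

/-- The phase `e^{2πi⟨q, Θ p⟩}` of the projective representations of
`ℤ²` used for twisting. -/
def twistPhase (φ : ℝ) (p q : Fin 2 → ℤ) : Circle :=
  Real.fourierChar (φ / 2 * (p 1 * q 0 - p 0 * q 1))

theorem twistPhase_neg_left_self (φ : ℝ) (p : Fin 2 → ℤ) : twistPhase φ (-p) p = 1 := by
  have h : φ / 2 * (((-p) 1 : ℤ) * (p 0 : ℝ) - ((-p) 0 : ℤ) * (p 1 : ℝ)) = 0 := by
    simp only [Pi.neg_apply, Int.cast_neg]; ring
  rw [twistPhase, h, AddChar.map_zero_eq_one]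

theorem twistPhase_mul_twistPhase_neg (φ : ℝ) (p q : Fin 2 → ℤ) :
    twistPhase φ p q * twistPhase (-φ) p q = 1 := by
  rw [twistPhase, twistPhase, ← AddChar.map_add_eq_mul]
  convert AddChar.map_zero_eq_one Real.fourierChar using 2
  ring

/-- An ambient `C^*`-algebra `𝓑` for twisting the `ℤ²`-graded subalgebras of `𝓐`: it contains a copy
of `𝓐` that commutes with a projective representation of `ℤ²` by unitaries, and the characters of
`ℤ²` are implemented on the twisted copies by unitaries of `𝓑`. -/
structure TwistSystem (φ : ℝ) (𝓐 𝓑 : Type*) [CStarAlgebra 𝓐] [CStarAlgebra 𝓑] where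
  /-- The copy of `𝓐` in `𝓑`. -/
  amp : 𝓐 →⋆ₐ[ℂ] 𝓑
  amp_injective : Function.Injective amp
  /-- The unitaries of the projective representation. -/
  weight : (Fin 2 → ℤ) → 𝓑
  weight_zero : weight 0 = 1
  weight_mul : ∀ p q, weight p * weight q = (twistPhase φ p q : ℂ) • weight (p + q)
  star_weight : ∀ p, star (weight p) = weight (-p)
  commute : ∀ a p, Commute (amp a) (weight p)
  exists_unitary : ∀ z : UnitAddTorus (Fin 2), ∃ v : unitary 𝓑, ∀ p a,
    (v : 𝓑) * (weight p * amp a) = UnitAddTorus.mFourier p z • (weight p * amp a * v)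

namespace TwistSystem

variable {φ : ℝ} {𝓐 𝓑 : Type*} [CStarAlgebra 𝓐] [CStarAlgebra 𝓑] (W : TwistSystem φ 𝓐 𝓑)

/-- The copy in degree `p` of an element of `𝓐`. -/
def twist (p : Fin 2 → ℤ) : 𝓐 →ₗ[ℂ] 𝓑 :=
  LinearMap.mulLeft ℂ (W.weight p) ∘ₗ (W.amp : 𝓐 →ₐ[ℂ] 𝓑).toLinearMap

theorem twist_apply (p : Fin 2 → ℤ) (a : 𝓐) : W.twist p a = W.weight p * W.amp a := rfl

theorem twist_zero_left (a : 𝓐) : W.twist 0 a = W.amp a := by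
  rw [twist_apply, W.weight_zero, one_mul]

theorem twist_mul_twist (p q : Fin 2 → ℤ) (a b : 𝓐) :
    W.twist p a * W.twist q b = (twistPhase φ p q : ℂ) • W.twist (p + q) (a * b) := by
  rw [twist_apply, twist_apply, twist_apply, map_mul, mul_assoc, ← mul_assoc (W.amp a),
    (W.commute a q).eq, mul_assoc, ← mul_assoc (W.weight p), W.weight_mul, smul_mul_assoc]

theorem star_twist (p : Fin 2 → ℤ) (a : 𝓐) : star (W.twist p a) = W.twist (-p) (star a) := by
  rw [twist_apply, twist_apply, star_mul, W.star_weight, ← map_star, (W.commute _ _).eq]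

theorem star_twist_mul_twist (p : Fin 2 → ℤ) (a b : 𝓐) :
    star (W.twist p a) * W.twist p b = W.amp (star a * b) := by
  rw [star_twist, twist_mul_twist, twistPhase_neg_left_self, neg_add_cancel, twist_zero_left,
    Circle.coe_one, one_smul]

theorem norm_twist (p : Fin 2 → ℤ) (a : 𝓐) : ‖W.twist p a‖ = ‖a‖ := by
  have h : ‖W.twist p a‖ * ‖W.twist p a‖ = ‖a‖ * ‖a‖ := by
    rw [← CStarRing.norm_star_mul_self, W.star_twist_mul_twist,
      NonUnitalStarAlgHom.norm_map W.amp W.amp_injective, CStarRing.norm_star_mul_self]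
  exact (mul_self_inj (norm_nonneg _) (norm_nonneg _)).1 h

theorem continuous_twist (p : Fin 2 → ℤ) : Continuous (W.twist p) :=
  AddMonoidHomClass.continuous_of_bound (W.twist p) 1 fun a => by rw [one_mul, W.norm_twist]

end TwistSystem

end Twist

/-! ### Generators and relations -/

section Presentations

namespace TwistedCuntzToeplitz

variable {n m : ℕ} {q : ℂ}

/-- The isometries `s_j` of the twisted algebra. -/
def genLeft (q : ℂ) (m : ℕ) (j : Fin n) : TwistedCuntzToeplitz n m q :=
  UniversalCStarAlgebra.of _ (FreeStarAlgebra.gen (Sum.inl j))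

/-- The isometries `t_r` of the twisted algebra. -/
def genRight (q : ℂ) (n : ℕ) (r : Fin m) : TwistedCuntzToeplitz n m q :=
  UniversalCStarAlgebra.of _ (FreeStarAlgebra.gen (Sum.inr r))

theorem relation_left (i j : Fin n) :
    star (genLeft q m i) * genLeft q m j = if i = j then 1 else 0 := by
  have h := UniversalCStarAlgebra.of_eq_zero (twistedRelators n m q) (Or.inl ⟨i, j, rfl⟩)
  rw [map_sub, map_mul, map_star, sub_eq_zero] at h
  exact h.trans (by split_ifs <;> simp)

theorem relation_right (r l : Fin m) :
    star (genRight q n r) * genRight q n l = if r = l then 1 else 0 := by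
  have h := UniversalCStarAlgebra.of_eq_zero (twistedRelators n m q) (Or.inr (Or.inl ⟨r, l, rfl⟩))
  rw [map_sub, map_mul, map_star, sub_eq_zero] at h
  exact h.trans (by split_ifs <;> simp)

theorem relation_star_left_right (j : Fin n) (r : Fin m) :
    star (genLeft q m j) * genRight q n r = q • (genRight q n r * star (genLeft q m j)) := by
  have h := UniversalCStarAlgebra.of_eq_zero (twistedRelators n m q) (Or.inr (Or.inr ⟨j, r, rfl⟩))
  rw [map_sub, map_mul, map_smul, map_mul, map_star, sub_eq_zero] at h
  exact h

/-- The relation `s_j t_r = \bar q t_r s_j` follows from the defining ones: the difference `x` of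
both sides satisfies `x^* x = 0`. -/
theorem relation_left_right (hq : ‖q‖ = 1) (j : Fin n) (r : Fin m) :
    genLeft q m j * genRight q n r = star q • (genRight q n r * genLeft q m j) := by
  have hqq : star q * q = 1 := by
    rw [Complex.star_def, Complex.conj_mul', hq]; simp
  set s := genLeft q m j
  set t := genRight q n r
  have hs : star s * s = 1 := by simpa using relation_left (q := q) (m := m) j j
  have ht : star t * t = 1 := by simpa using relation_right (q := q) (n := n) r r
  have h1 : star s * t = q • (t * star s) := relation_star_left_right j r
  have h2 : star t * s = star q • (s * star t) := by
    simpa [star_mul, star_smul] using congrArg star h1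
  have a1 : star (s * t) * (s * t) = 1 := by
    rw [star_mul, mul_assoc, ← mul_assoc (star s), hs, one_mul, ht]
  have a2 : star (t * s) * (t * s) = 1 := by
    rw [star_mul, mul_assoc, ← mul_assoc (star t), ht, one_mul, hs]
  have a3 : star (s * t) * (t * s) = q • 1 := by
    rw [star_mul, mul_assoc, ← mul_assoc (star s), h1, smul_mul_assoc, mul_assoc t, hs, mul_one,
      mul_smul_comm, ht]
  have a4 : star (t * s) * (s * t) = star q • 1 := by
    rw [star_mul, mul_assoc, ← mul_assoc (star t), h2, smul_mul_assoc, mul_assoc s, ht, mul_one,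
      mul_smul_comm, hs]
  have h0 : star (s * t - star q • (t * s)) * (s * t - star q • (t * s)) = 0 := by
    rw [star_sub, star_smul, star_star, sub_mul, mul_sub, mul_sub, a1, smul_mul_assoc, a4,
      mul_smul_comm, a3, smul_mul_smul_comm, a2, smul_smul, smul_smul, mul_comm q, hqq]
    simp
  exact sub_eq_zero.1 (CStarRing.star_mul_self_eq_zero_iff _ |>.1 h0)

theorem eq_top_of_mem (S : StarSubalgebra ℂ (TwistedCuntzToeplitz n m q))
    (hS : IsClosed (S : Set (TwistedCuntzToeplitz n m q)))
    (h : Set.range (genLeft q m) ∪ Set.range (genRight q n) ⊆ S) : S = ⊤ :=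
  UniversalCStarAlgebra.eq_top_of_gen_mem _ S hS fun x => by
    cases x with
    | inl j => exact h (Or.inl ⟨j, rfl⟩)
    | inr r => exact h (Or.inr ⟨r, rfl⟩)

theorem exists_hom {C : Type*} [CStarAlgebra C] (s : Fin n → C) (t : Fin m → C)
    (hs : ∀ i j, star (s i) * s j = if i = j then 1 else 0)
    (ht : ∀ i j, star (t i) * t j = if i = j then 1 else 0)
    (hst : ∀ i j, star (s i) * t j = q • (t j * star (s i))) :
    ∃ F : TwistedCuntzToeplitz n m q →⋆ₐ[ℂ] C,
      (∀ j, F (genLeft q m j) = s j) ∧ ∀ r, F (genRight q n r) = t r := by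
  refine ⟨UniversalCStarAlgebra.lift _ (FreeStarAlgebra.lift (Sum.elim s t)) ?_, fun j => ?_,
    fun r => ?_⟩
  · rintro _ (⟨i, j, rfl⟩ | ⟨i, j, rfl⟩ | ⟨i, j, rfl⟩)
    · rw [map_sub, map_mul, map_star, FreeStarAlgebra.lift_gen, FreeStarAlgebra.lift_gen,
        Sum.elim_inl, Sum.elim_inl, hs]
      split_ifs <;> simp
    · rw [map_sub, map_mul, map_star, FreeStarAlgebra.lift_gen, FreeStarAlgebra.lift_gen,
        Sum.elim_inr, Sum.elim_inr, ht]
      split_ifs <;> simp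
    · rw [map_sub, map_mul, map_smul, map_mul, map_star, FreeStarAlgebra.lift_gen,
        FreeStarAlgebra.lift_gen, Sum.elim_inl, Sum.elim_inr, hst, sub_self]
  · exact (UniversalCStarAlgebra.lift_of _ _ _ _).trans (FreeStarAlgebra.lift_gen _ _)
  · exact (UniversalCStarAlgebra.lift_of _ _ _ _).trans (FreeStarAlgebra.lift_gen _ _)

end TwistedCuntzToeplitz

namespace CuntzToeplitz

variable {n m : ℕ}

theorem eq_top_of_mem (S : StarSubalgebra ℂ (CuntzToeplitz n))
    (hS : IsClosed (S : Set (CuntzToeplitz n))) (h : ∀ j, gen j ∈ S) : S = ⊤ :=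
  UniversalCStarAlgebra.eq_top_of_gen_mem _ S hS h

theorem exists_hom {C : Type*} [CStarAlgebra C] (s : Fin n → C)
    (hs : ∀ i j, star (s i) * s j = if i = j then 1 else 0) :
    ∃ F : CuntzToeplitz n →⋆ₐ[ℂ] C, ∀ j, F (gen j) = s j := by
  refine ⟨UniversalCStarAlgebra.lift _ (FreeStarAlgebra.lift s) ?_, fun j => ?_⟩
  · rintro _ ⟨i, j, rfl⟩
    rw [map_sub, map_mul, map_star, FreeStarAlgebra.lift_gen, FreeStarAlgebra.lift_gen, hs]
    split_ifs <;> simp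
  · exact (UniversalCStarAlgebra.lift_of _ _ _ _).trans (FreeStarAlgebra.lift_gen _ _)

/-- `s_j ⊗ 1`. -/
def tensorGenLeft (m : ℕ) (j : Fin n) : CStarTensor (CuntzToeplitz n) (CuntzToeplitz m) :=
  CStarTensor.inl _ _ (gen j)

/-- `1 ⊗ s_r`. -/
def tensorGenRight (n : ℕ) (r : Fin m) : CStarTensor (CuntzToeplitz n) (CuntzToeplitz m) :=
  CStarTensor.inr _ _ (gen r)

theorem tensor_eq_top_of_mem
    (S : StarSubalgebra ℂ (CStarTensor (CuntzToeplitz n) (CuntzToeplitz m)))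
    (hS : IsClosed (S : Set (CStarTensor (CuntzToeplitz n) (CuntzToeplitz m))))
    (h : Set.range (tensorGenLeft m) ∪ Set.range (tensorGenRight n) ⊆ S) : S = ⊤ := by
  refine CStarTensor.eq_top_of_mem S hS (fun a => ?_) fun b => ?_
  · have h1 := eq_top_of_mem (S.comap (CStarTensor.inl (CuntzToeplitz n) (CuntzToeplitz m)))
      (by rw [StarSubalgebra.coe_comap]; exact hS.preimage (StarAlgHom.continuous_of_cstar _))
      fun j => h (Or.inl ⟨j, rfl⟩)
    have h2 : a ∈ S.comap (CStarTensor.inl (CuntzToeplitz n) (CuntzToeplitz m)) := by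
      rw [h1]; trivial
    exact h2
  · have h1 := eq_top_of_mem (S.comap (CStarTensor.inr (CuntzToeplitz n) (CuntzToeplitz m)))
      (by rw [StarSubalgebra.coe_comap]; exact hS.preimage (StarAlgHom.continuous_of_cstar _))
      fun j => h (Or.inr ⟨j, rfl⟩)
    have h2 : b ∈ S.comap (CStarTensor.inr (CuntzToeplitz n) (CuntzToeplitz m)) := by
      rw [h1]; trivial
    exact h2

/-- Two representations of Cuntz-Toeplitz algebras have commuting ranges as soon as the images of
the generators `*`-commute. -/
theorem commute_of_generators {C : Type*} [CStarAlgebra C] (f : CuntzToeplitz n →⋆ₐ[ℂ] C)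
    (g : CuntzToeplitz m →⋆ₐ[ℂ] C) (h1 : ∀ j r, Commute (f (gen j)) (g (gen r)))
    (h2 : ∀ j r, Commute (star (f (gen j))) (g (gen r))) (a : CuntzToeplitz n)
    (b : CuntzToeplitz m) : Commute (f a) (g b) := by
  have key : ∀ {k : ℕ} (F : CuntzToeplitz k →⋆ₐ[ℂ] C) (x : C),
      (∀ j, Commute (F (gen j)) x) → (∀ j, Commute (F (gen j)) (star x)) →
      ∀ a, Commute (F a) x := by
    intro k F x hx hx' a
    have htop := eq_top_of_mem ((StarSubalgebra.centralizer ℂ {x}).comap F) ?_ fun j => ?_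
    · have ha : a ∈ (StarSubalgebra.centralizer ℂ {x}).comap F := by rw [htop]; trivial
      have ha' : F a ∈ StarSubalgebra.centralizer ℂ {x} := ha
      rw [StarSubalgebra.mem_centralizer_iff] at ha'
      exact ((ha' x rfl).1).symm
    · rw [StarSubalgebra.coe_comap]
      refine IsClosed.preimage F.continuous_of_cstar ?_
      exact Set.isClosed_centralizer _
    · change F (gen j) ∈ StarSubalgebra.centralizer ℂ {x}
      rw [StarSubalgebra.mem_centralizer_iff]
      rintro _ rfl
      exact ⟨(hx j).symm, (hx' j).symm⟩
  have hA : ∀ j b, Commute (g b) (f (gen j)) := fun j =>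
    key g (f (gen j)) (fun r => (h1 j r).symm) (fun r => (h2 j r).symm)
  exact key f (g b) (fun j => (hA j b).symm)
    (fun j => by rw [← map_star]; exact (hA j (star b)).symm) a

end CuntzToeplitz

end Presentations

/-! ### The twist system on square integrable functions -/

section LpTwist

/-- An integer vector as an element of the Euclidean plane. -/
def momentum (p : Fin 2 → ℤ) : EuclideanSpace ℝ (Fin 2) := WithLp.toLp 2 fun i => (p i : ℝ)

/-- The translation vector `Θ p` that goes with the character `p`. -/
def thetaShift (φ : ℝ) (p : Fin 2 → ℤ) : EuclideanSpace ℝ (Fin 2) :=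
  Matrix.toEuclideanLin (thetaMatrix φ) (momentum p)

theorem momentum_add (p q : Fin 2 → ℤ) : momentum (p + q) = momentum p + momentum q := by
  ext i; simp [momentum]

theorem momentum_neg (p : Fin 2 → ℤ) : momentum (-p) = -momentum p := by
  ext i; simp [momentum]

theorem momentum_zero : momentum 0 = 0 := by
  ext i; simp [momentum]

theorem thetaShift_add (φ : ℝ) (p q : Fin 2 → ℤ) :
    thetaShift φ (p + q) = thetaShift φ p + thetaShift φ q := by
  rw [thetaShift, momentum_add, map_add]; rfl

theorem thetaShift_neg (φ : ℝ) (p : Fin 2 → ℤ) : thetaShift φ (-p) = -thetaShift φ p := by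
  rw [thetaShift, momentum_neg, map_neg]; rfl

theorem thetaShift_zero (φ : ℝ) : thetaShift φ 0 = 0 := by
  rw [thetaShift, momentum_zero, map_zero]

theorem inner_momentum_thetaShift (φ : ℝ) (p q : Fin 2 → ℤ) :
    inner ℝ (momentum q) (thetaShift φ p) = φ / 2 * (p 1 * q 0 - p 0 * q 1) := by
  simp [thetaShift, momentum, thetaMatrix, PiLp.inner_apply, Fin.sum_univ_two,
    Matrix.toEuclideanLin, Matrix.toLpLin, dotProduct]
  ring

variable {H : Type*} [NormedAddCommGroup H] [InnerProductSpace ℂ H] [CompleteSpace H]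

/-- A rule for moving a unitary past a product, isolated from the operators on `L²`. -/
theorem mul_mul_eq_of_commute {R : Type*} [Ring R] [Algebra ℂ R] {u v a : R} {c : ℂ}
    (huv : u * v = c • (v * u)) (hau : Commute a u) : u * (v * a) = c • (v * a * u) := by
  rw [← mul_assoc, huv, smul_mul_assoc, mul_assoc, mul_assoc, hau.eq]

theorem mFourier_coe (p : Fin 2 → ℤ) (y : EuclideanSpace ℝ (Fin 2)) :
    UnitAddTorus.mFourier p (fun i => (y i : UnitAddCircle)) =
      Real.fourierChar (inner ℝ (momentum p) y) := by
  change ∏ i, fourier (p i) ((y i : ℝ) : UnitAddCircle) = _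
  rw [Fin.prod_univ_two, fourier_coe_apply, fourier_coe_apply, ← Complex.exp_add,
    Real.fourierChar_apply]
  congr 1
  simp [momentum, PiLp.inner_apply, Fin.sum_univ_two]
  ring

theorem weyl_mem_unitary (y : EuclideanSpace ℝ (Fin 2)) : weyl H 0 y ∈ unitary
    (Lp H 2 (volume : Measure (EuclideanSpace ℝ (Fin 2))) →L[ℂ]
      Lp H 2 (volume : Measure (EuclideanSpace ℝ (Fin 2)))) := by
  have h := star_weyl (H := H) 0 y
  rw [inner_zero_left, AddChar.map_zero_eq_one, Circle.coe_one, neg_zero] at h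
  have h1 : star (weyl H 0 y) = weyl H 0 (-y) := h.trans (one_smul ℂ _)
  refine ⟨star_weyl_mul_weyl 0 y, ?_⟩
  have h2 := star_weyl_mul_weyl (H := H) 0 (-y)
  rwa [← h1, star_star] at h2

theorem weyl_momentum_mul (φ : ℝ) (p q : Fin 2 → ℤ) :
    weyl H (momentum p) (thetaShift φ p) * weyl H (momentum q) (thetaShift φ q) =
      (twistPhase φ p q : ℂ) • weyl H (momentum (p + q)) (thetaShift φ (p + q)) := by
  have h := weyl_mul_weyl (H := H) (momentum p) (thetaShift φ p) (momentum q) (thetaShift φ q)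
  rwa [inner_momentum_thetaShift, ← momentum_add, ← thetaShift_add] at h

theorem star_weyl_momentum (φ : ℝ) (p : Fin 2 → ℤ) :
    star (weyl H (momentum p) (thetaShift φ p)) = weyl H (momentum (-p)) (thetaShift φ (-p)) := by
  have h0 : φ / 2 * ((p 1 : ℝ) * (p 0 : ℝ) - (p 0 : ℝ) * (p 1 : ℝ)) = 0 := by ring
  rw [star_weyl, inner_momentum_thetaShift, h0, AddChar.map_zero_eq_one, Circle.coe_one,
    momentum_neg, thetaShift_neg]
  exact one_smul ℂ _

theorem exists_coe_eq (z : UnitAddTorus (Fin 2)) :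
    ∃ y : EuclideanSpace ℝ (Fin 2), (fun i => (y i : UnitAddCircle)) = z := by
  choose y hy using fun i => QuotientAddGroup.mk_surjective (z i)
  exact ⟨WithLp.toLp 2 y, funext hy⟩

/-- Translations implement the characters of `ℤ²` on the twisted operators. -/
theorem weyl_mul_weyl_mul_amplify (y : EuclideanSpace ℝ (Fin 2)) (p : Fin 2 → ℤ)
    (y' : EuclideanSpace ℝ (Fin 2)) (B : H →L[ℂ] H) :
    weyl H 0 y * (weyl H (momentum p) y' * amplify 2 H B) =
      UnitAddTorus.mFourier p (fun i => (y i : UnitAddCircle)) •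
        (weyl H (momentum p) y' * amplify 2 H B * weyl H 0 y) := by
  have h1 := weyl_mul_weyl (H := H) 0 y (momentum p) y'
  have h2 := weyl_mul_weyl (H := H) (momentum p) y' 0 y
  rw [zero_add (momentum p)] at h1
  rw [inner_zero_left, AddChar.map_zero_eq_one, Circle.coe_one, add_zero (momentum p),
    add_comm y'] at h2
  have h3 : weyl H (momentum p) y' * weyl H 0 y = weyl H (momentum p) (y + y') :=
    h2.trans (one_smul ℂ _)
  rw [← h3, ← mFourier_coe] at h1
  exact mul_mul_eq_of_commute h1 (commute_amplify_weyl B 0 y)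

set_option maxHeartbeats 1000000 in
/-- The twist system of the Weyl operators `f ↦ (x ↦ e^{2πi⟨p, x⟩} f(x + Θ p))` on `L²(ℝ², H)`. -/
def lpTwistSystem (φ : ℝ) (H : Type*) [NormedAddCommGroup H] [InnerProductSpace ℂ H]
    [CompleteSpace H] : TwistSystem φ (H →L[ℂ] H)
      (Lp H 2 (volume : Measure (EuclideanSpace ℝ (Fin 2))) →L[ℂ]
        Lp H 2 (volume : Measure (EuclideanSpace ℝ (Fin 2)))) where
  amp := amplify 2 H
  amp_injective := amplify_injective
  weight p := weyl H (momentum p) (thetaShift φ p)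
  weight_zero := by rw [momentum_zero, thetaShift_zero, weyl_zero]
  weight_mul := weyl_momentum_mul φ
  star_weight := star_weyl_momentum φ
  commute B p := commute_amplify_weyl B _ _
  exists_unitary z := by
    have hy := (exists_coe_eq z).choose_spec
    refine ⟨⟨weyl H 0 (exists_coe_eq z).choose, weyl_mem_unitary _⟩, fun p B => ?_⟩
    have h := weyl_mul_weyl_mul_amplify (exists_coe_eq z).choose p (thetaShift φ p) B
    rw [hy] at h
    exact h

end LpTwist

/-! ### Twisting representations forth and back -/

section TwistedRepresentations

open UnitAddTorus

theorem StarAlgHom.ext_of_generators {B C : Type*} [CStarAlgebra B] [CStarAlgebra C] {s : Set B}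
    (hgen : ∀ S : StarSubalgebra ℂ B, IsClosed (S : Set B) → s ⊆ S → S = ⊤)
    {φ ψ : B →⋆ₐ[ℂ] C} (h : ∀ a ∈ s, φ a = ψ a) : φ = ψ := by
  have htop := hgen (StarAlgHom.equalizer φ ψ)
    (isClosed_eq φ.continuous_of_cstar ψ.continuous_of_cstar) h
  ext a
  have ha : a ∈ StarAlgHom.equalizer φ ψ := by rw [htop]; trivial
  exact ha

/-- The twisted representation of `E_{n,m}^q` that comes from a representation of
`O_n^{(0)} ⊗ O_m^{(0)}`. -/
theorem TwistedCuntzToeplitz.exists_twist {n m : ℕ} {q : ℂ} {φ : ℝ}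
    (hφ : q = Real.fourierChar φ) {𝓐 𝓑 : Type*} [CStarAlgebra 𝓐] [CStarAlgebra 𝓑]
    (W : TwistSystem φ 𝓐 𝓑) (π : CStarTensor (CuntzToeplitz n) (CuntzToeplitz m) →⋆ₐ[ℂ] 𝓐) :
    ∃ Φ : TwistedCuntzToeplitz n m q →⋆ₐ[ℂ] 𝓑,
      (∀ j, Φ (genLeft q m j) = W.twist (Pi.single 0 1) (π (CuntzToeplitz.tensorGenLeft m j))) ∧
      ∀ r, Φ (genRight q n r) = W.twist (Pi.single 1 1) (π (CuntzToeplitz.tensorGenRight n r)) := by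
  refine exists_hom _ _ (fun i j => ?_) (fun i j => ?_) fun i j => ?_
  · rw [W.star_twist_mul_twist, CuntzToeplitz.tensorGenLeft, CuntzToeplitz.tensorGenLeft,
      ← map_star, ← map_star, ← map_mul, ← map_mul, CuntzToeplitz.relation]
    split_ifs
    · rw [map_one, map_one, map_one]
    · rw [map_zero, map_zero, map_zero]
  · rw [W.star_twist_mul_twist, CuntzToeplitz.tensorGenRight, CuntzToeplitz.tensorGenRight,
      ← map_star, ← map_star, ← map_mul, ← map_mul, CuntzToeplitz.relation]
    split_ifs
    · rw [map_one, map_one, map_one]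
    · rw [map_zero, map_zero, map_zero]
  · have hc : Commute (star (π (CuntzToeplitz.tensorGenLeft m i)))
        (π (CuntzToeplitz.tensorGenRight n j)) := by
      rw [CuntzToeplitz.tensorGenLeft, CuntzToeplitz.tensorGenRight, ← map_star, ← map_star]
      exact (CStarTensor.commute_inl_inr _ _).map π
    have hphase : (twistPhase φ (-Pi.single 0 1) (Pi.single 1 1) : ℂ) =
        q * (twistPhase φ (Pi.single 1 1) (-Pi.single 0 1) : ℂ) := by
      rw [hφ, twistPhase, twistPhase, ← Circle.coe_mul, ← AddChar.map_add_eq_mul]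
      congr 2
      simp
      ring
    rw [W.star_twist, W.twist_mul_twist, W.twist_mul_twist, hc.eq, hphase,
      add_comm (-Pi.single 0 1 : Fin 2 → ℤ)]
    rw [mul_smul]

/-- The representation of `O_n^{(0)} ⊗ O_m^{(0)}` that comes from a representation of `E_{n,m}^q`
by twisting back. -/
theorem TwistedCuntzToeplitz.exists_untwist {n m : ℕ} {q : ℂ} {φ : ℝ}
    (hφ : q = Real.fourierChar φ) {𝓐 𝓑 : Type*} [CStarAlgebra 𝓐] [CStarAlgebra 𝓑]
    (W : TwistSystem (-φ) 𝓐 𝓑) (ρ : TwistedCuntzToeplitz n m q →⋆ₐ[ℂ] 𝓐) :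
    ∃ Ψ : CStarTensor (CuntzToeplitz n) (CuntzToeplitz m) →⋆ₐ[ℂ] 𝓑,
      (∀ j, Ψ (CuntzToeplitz.tensorGenLeft m j) =
        W.twist (Pi.single 0 1) (ρ (genLeft q m j))) ∧
      ∀ r, Ψ (CuntzToeplitz.tensorGenRight n r) =
        W.twist (Pi.single 1 1) (ρ (genRight q n r)) := by
  have hq : ‖q‖ = 1 := by rw [hφ]; exact Circle.norm_coe _
  obtain ⟨f, hf⟩ := CuntzToeplitz.exists_hom
    (fun j => W.twist (Pi.single 0 1) (ρ (genLeft q m j))) (fun i j => by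
      rw [W.star_twist_mul_twist, ← map_star, ← map_mul, relation_left]
      split_ifs
      · rw [map_one, map_one]
      · rw [map_zero, map_zero])
  obtain ⟨g, hg⟩ := CuntzToeplitz.exists_hom
    (fun r => W.twist (Pi.single 1 1) (ρ (genRight q n r))) (fun i j => by
      rw [W.star_twist_mul_twist, ← map_star, ← map_mul, relation_right]
      split_ifs
      · rw [map_one, map_one]
      · rw [map_zero, map_zero])
  have hcomm : ∀ a b, Commute (f a) (g b) := by
    refine CuntzToeplitz.commute_of_generators f g (fun j r => ?_) fun j r => ?_
    · have hphase : (twistPhase (-φ) (Pi.single 0 1) (Pi.single 1 1) : ℂ) * star q =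
          (twistPhase (-φ) (Pi.single 1 1) (Pi.single 0 1) : ℂ) := by
        rw [hφ, Complex.star_def, ← Circle.coe_inv_eq_conj, twistPhase, twistPhase,
          ← AddChar.map_neg_eq_inv, ← Circle.coe_mul, ← AddChar.map_add_eq_mul]
        congr 2
        simp
        ring
      rw [commute_iff_eq, hf, hg, W.twist_mul_twist, W.twist_mul_twist, ← map_mul, ← map_mul,
        relation_left_right hq, map_smul, map_smul, ← hphase,
        add_comm (Pi.single 0 1 : Fin 2 → ℤ)]
      rw [mul_smul]
    · have hphase : (twistPhase (-φ) (-Pi.single 0 1) (Pi.single 1 1) : ℂ) * q =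
          (twistPhase (-φ) (Pi.single 1 1) (-Pi.single 0 1) : ℂ) := by
        rw [hφ, twistPhase, twistPhase, ← Circle.coe_mul, ← AddChar.map_add_eq_mul]
        congr 2
        simp
        ring
      rw [commute_iff_eq, hf, hg, W.star_twist, W.twist_mul_twist, W.twist_mul_twist, ← map_star,
        ← map_mul, ← map_mul, relation_star_left_right, map_smul, map_smul, ← hphase,
        add_comm (-Pi.single 0 1 : Fin 2 → ℤ)]
      rw [mul_smul]
  obtain ⟨Ψ, h1, h2⟩ := CStarTensor.exists_hom_of_commute f g hcomm
  exact ⟨Ψ, fun j => (h1 _).trans (hf j), fun r => (h2 _).trans (hg r)⟩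

end TwistedRepresentations

/-! ### The gauge actions -/

section Gauge

open UnitAddTorus

theorem star_mFourier_mul_self {d : Type*} [Fintype d] (p : d → ℤ) (z : UnitAddTorus d) :
    star (mFourier p z) * mFourier p z = 1 := by
  rw [Complex.star_def, Complex.conj_mul', norm_mFourier_apply]; simp

theorem mFourier_apply_zero {d : Type*} [Fintype d] (p : d → ℤ) : mFourier p 0 = 1 := by
  change ∏ i, fourier (p i) (0 : UnitAddCircle) = 1
  simp

/-- The gauge action of the torus `(ℝ/ℤ)²` on `E_{n,m}^q`. -/
theorem TwistedCuntzToeplitz.exists_gauge {n m : ℕ} {q : ℂ} :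
    ∃ γ : UnitAddTorus (Fin 2) → (TwistedCuntzToeplitz n m q →⋆ₐ[ℂ] TwistedCuntzToeplitz n m q),
      IsTorusAction γ ∧ (∀ j, genLeft q m j ∈ isotypic γ (Pi.single 0 1)) ∧
        ∀ r, genRight q n r ∈ isotypic γ (Pi.single 1 1) := by
  have h : ∀ z : UnitAddTorus (Fin 2),
      ∃ F : TwistedCuntzToeplitz n m q →⋆ₐ[ℂ] TwistedCuntzToeplitz n m q,
        (∀ j, F (genLeft q m j) = mFourier (Pi.single 0 1) z • genLeft q m j) ∧
        ∀ r, F (genRight q n r) = mFourier (Pi.single 1 1) z • genRight q n r := by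
    intro z
    refine exists_hom _ _ (fun i j => ?_) (fun i j => ?_) fun i j => ?_
    · rw [star_smul, smul_mul_smul_comm, star_mFourier_mul_self, one_smul, relation_left]
    · rw [star_smul, smul_mul_smul_comm, star_mFourier_mul_self, one_smul, relation_right]
    · rw [star_smul, smul_mul_smul_comm, smul_mul_smul_comm, relation_star_left_right,
        smul_comm q, mul_comm]
  choose γ hγ1 hγ2 using h
  have hext := fun (F G : TwistedCuntzToeplitz n m q →⋆ₐ[ℂ] TwistedCuntzToeplitz n m q) =>
    StarAlgHom.ext_of_generators (φ := F) (ψ := G) eq_top_of_mem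
  refine ⟨γ, ⟨hext _ _ ?_, fun z w => hext _ _ ?_, ?_⟩, fun j z => hγ1 z j, fun r z => hγ2 z r⟩
  · rintro _ (⟨j, rfl⟩ | ⟨r, rfl⟩)
    · rw [hγ1, mFourier_apply_zero, one_smul]; rfl
    · rw [hγ2, mFourier_apply_zero, one_smul]; rfl
  · rintro _ (⟨j, rfl⟩ | ⟨r, rfl⟩)
    · rw [StarAlgHom.comp_apply, hγ1, hγ1, map_smul, hγ1, smul_smul, mFourier_apply_add, mul_comm]
    · rw [StarAlgHom.comp_apply, hγ2, hγ2, map_smul, hγ2, smul_smul, mFourier_apply_add, mul_comm]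
  · refine continuous_orbit_of_generators eq_top_of_mem ?_
    rintro _ (⟨j, rfl⟩ | ⟨r, rfl⟩)
    · simp only [hγ1]; fun_prop
    · simp only [hγ2]; fun_prop

namespace CuntzToeplitz

variable {n m : ℕ}

/-- The gauge action of the torus `(ℝ/ℤ)²` on `O_n^{(0)} ⊗ O_m^{(0)}`. -/
def tensorGauge (n m : ℕ) (z : UnitAddTorus (Fin 2)) :
    CStarTensor (CuntzToeplitz n) (CuntzToeplitz m) →⋆ₐ[ℂ]
      CStarTensor (CuntzToeplitz n) (CuntzToeplitz m) :=
  CStarTensor.map (gaugeHom n (z 0).toCircle) (gaugeHom m (z 1).toCircle)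

theorem gaugeAction_apply (x : EuclideanSpace ℝ (Fin 2))
    (a : CStarTensor (CuntzToeplitz n) (CuntzToeplitz m)) :
    gaugeAction n m (Multiplicative.ofAdd x) a =
      tensorGauge n m (fun i => (x i : UnitAddCircle)) a := by
  have h : ∀ t : ℝ, Real.fourierChar t = AddCircle.toCircle (t : UnitAddCircle) := fun t => by
    rw [AddCircle.toCircle_apply_mk, Real.fourierChar_apply', div_one]
  change CStarTensor.map (gaugeHom n (Real.fourierChar (x 0)))
    (gaugeHom m (Real.fourierChar (x 1))) a = _
  rw [h, h]
  rfl

theorem tensorGenLeft_mem_isotypic (j : Fin n) :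
    tensorGenLeft m j ∈ isotypic (tensorGauge n m) (Pi.single 0 1) := fun z => by
  rw [tensorGenLeft, CStarTensor.inl_apply, tensorGauge, CStarTensor.map_tmul, gaugeHom_gen,
    map_one, mFourier_single, fourier_one, ← CStarTensor.inl_apply, map_smul]
  rfl

theorem tensorGenRight_mem_isotypic (r : Fin m) :
    tensorGenRight n r ∈ isotypic (tensorGauge n m) (Pi.single 1 1) := fun z => by
  rw [tensorGenRight, CStarTensor.inr_apply, tensorGauge, CStarTensor.map_tmul, gaugeHom_gen,
    map_one, mFourier_single, fourier_one, ← CStarTensor.inr_apply, map_smul]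
  rfl

theorem isTorusAction_tensorGauge : IsTorusAction (tensorGauge n m) := by
  have hext := fun (F G : CStarTensor (CuntzToeplitz n) (CuntzToeplitz m) →⋆ₐ[ℂ]
      CStarTensor (CuntzToeplitz n) (CuntzToeplitz m)) =>
    StarAlgHom.ext_of_generators (φ := F) (ψ := G) tensor_eq_top_of_mem
  refine ⟨hext _ _ ?_, fun z w => hext _ _ ?_, ?_⟩
  · rintro _ (⟨j, rfl⟩ | ⟨r, rfl⟩)
    · rw [tensorGenLeft_mem_isotypic, mFourier_apply_zero, one_smul]; rfl
    · rw [tensorGenRight_mem_isotypic, mFourier_apply_zero, one_smul]; rfl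
  · rintro _ (⟨j, rfl⟩ | ⟨r, rfl⟩)
    · rw [StarAlgHom.comp_apply, tensorGenLeft_mem_isotypic, tensorGenLeft_mem_isotypic j w,
        map_smul, tensorGenLeft_mem_isotypic, smul_smul, mFourier_apply_add, mul_comm]
    · rw [StarAlgHom.comp_apply, tensorGenRight_mem_isotypic, tensorGenRight_mem_isotypic r w,
        map_smul, tensorGenRight_mem_isotypic, smul_smul, mFourier_apply_add, mul_comm]
  · refine continuous_orbit_of_generators tensor_eq_top_of_mem ?_
    rintro _ (⟨j, rfl⟩ | ⟨r, rfl⟩)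
    · simp only [tensorGenLeft_mem_isotypic _ _]; fun_prop
    · simp only [tensorGenRight_mem_isotypic _ _]; fun_prop

end CuntzToeplitz

end Gauge

/-! ### Comparison of the twisted algebra with its image -/

section Comparison

namespace TwistedCuntzToeplitz

variable {n m : ℕ} {q : ℂ} {φ : ℝ} {𝓐 𝓑 : Type*} [CStarAlgebra 𝓐] [CStarAlgebra 𝓑]
  {W : TwistSystem φ 𝓐 𝓑} {π : CStarTensor (CuntzToeplitz n) (CuntzToeplitz m) →⋆ₐ[ℂ] 𝓐}
  {Φ : TwistedCuntzToeplitz n m q →⋆ₐ[ℂ] 𝓑}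

/-- Twisting back: on homogeneous elements, every representation of the twisted algebra is
dominated by the twist of a faithful representation of the tensor product. -/
theorem norm_apply_coeff_le (hφ : q = Real.fourierChar φ) (hπ : Function.Injective π)
    (hΦl : ∀ j, Φ (genLeft q m j) = W.twist (Pi.single 0 1) (π (CuntzToeplitz.tensorGenLeft m j)))
    (hΦr : ∀ r, Φ (genRight q n r) = W.twist (Pi.single 1 1) (π (CuntzToeplitz.tensorGenRight n r)))
    {γ : UnitAddTorus (Fin 2) → (TwistedCuntzToeplitz n m q →⋆ₐ[ℂ] TwistedCuntzToeplitz n m q)}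
    (hγ : IsTorusAction γ) (hγl : ∀ j, genLeft q m j ∈ isotypic γ (Pi.single 0 1))
    (hγr : ∀ r, genRight q n r ∈ isotypic γ (Pi.single 1 1))
    {𝓐' 𝓑' : Type*} [CStarAlgebra 𝓐'] [CStarAlgebra 𝓑'] (W' : TwistSystem (-φ) 𝓐' 𝓑')
    (ρ : TwistedCuntzToeplitz n m q →⋆ₐ[ℂ] 𝓐') (p : Fin 2 → ℤ) (x : TwistedCuntzToeplitz n m q) :
    ‖ρ (hγ.coeff p x)‖ ≤ ‖Φ (hγ.coeff p x)‖ := by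
  obtain ⟨Ψ, hΨl, hΨr⟩ := exists_untwist hφ W' ρ
  -- homogeneous elements with a common counterpart in the tensor product
  let G : (Fin 2 → ℤ) → Submodule ℂ (TwistedCuntzToeplitz n m q) := fun p =>
    { carrier := {x | x ∈ isotypic γ p ∧
        ∃ a, Φ x = W.twist p (π a) ∧ Ψ a = W'.twist p (ρ x)}
      add_mem' := by
        rintro x y ⟨hx, a, ha, ha'⟩ ⟨hy, b, hb, hb'⟩
        exact ⟨add_mem hx hy, a + b, by simp only [map_add, ha, hb],
          by simp only [map_add, ha', hb']⟩
      zero_mem' := ⟨zero_mem _, 0, by simp, by simp⟩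
      smul_mem' := by
        rintro c x ⟨hx, a, ha, ha'⟩
        exact ⟨Submodule.smul_mem _ c hx, c • a, by simp only [map_smul, ha],
          by simp only [map_smul, ha']⟩ }
  have hmem := hγ.coeff_mem_closure G (fun p x hx => hx.1) ?_ ?_ ?_
    (s := Set.range (genLeft q m) ∪ Set.range (genRight q n)) ?_ eq_top_of_mem p x
  · have hcl : IsClosed {x : TwistedCuntzToeplitz n m q | ‖ρ x‖ ≤ ‖Φ x‖} :=
      isClosed_le (continuous_norm.comp ρ.continuous_of_cstar)
        (continuous_norm.comp Φ.continuous_of_cstar)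
    refine closure_minimal ?_ hcl hmem
    rintro y ⟨-, a, ha, ha'⟩
    change ‖ρ y‖ ≤ ‖Φ y‖
    rw [ha, W.norm_twist, NonUnitalStarAlgHom.norm_map π hπ, ← W'.norm_twist p, ← ha']
    exact NonUnitalStarAlgHom.norm_apply_le Ψ a
  · refine ⟨fun z => by rw [map_one, UnitAddTorus.mFourier_zero]; simp, 1, ?_, ?_⟩
    · rw [map_one, map_one, W.twist_zero_left, map_one]
    · rw [map_one, map_one, W'.twist_zero_left, map_one]
  · rintro p r x ⟨hx, a, ha, ha'⟩ y ⟨hy, b, hb, hb'⟩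
    refine ⟨fun z => ?_, (twistPhase φ p r : ℂ) • (a * b), ?_, ?_⟩
    · rw [map_mul, hx z, hy z, smul_mul_smul_comm, UnitAddTorus.mFourier_add]
    · rw [map_mul, ha, hb, W.twist_mul_twist, map_smul, map_smul, map_mul π]
    · rw [map_smul, map_mul, ha', hb', W'.twist_mul_twist, smul_smul, ← Circle.coe_mul,
        twistPhase_mul_twistPhase_neg, Circle.coe_one, one_smul, map_mul ρ]
  · rintro p x ⟨hx, a, ha, ha'⟩
    refine ⟨fun z => ?_, star a, ?_, ?_⟩
    · rw [map_star, hx z, star_smul, UnitAddTorus.mFourier_neg]; rfl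
    · rw [map_star, ha, W.star_twist, map_star π]
    · rw [map_star, ha', W'.star_twist, map_star ρ]
  · rintro _ (⟨j, rfl⟩ | ⟨r, rfl⟩)
    · exact ⟨_, hγl j, _, hΦl j, hΨl j⟩
    · exact ⟨_, hγr r, _, hΦr r, hΨr r⟩

/-- The kernel of the twisted representation is invariant under the gauge action. -/
theorem apply_gauge_eq_zero
    (hΦl : ∀ j, Φ (genLeft q m j) = W.twist (Pi.single 0 1) (π (CuntzToeplitz.tensorGenLeft m j)))
    (hΦr : ∀ r, Φ (genRight q n r) = W.twist (Pi.single 1 1) (π (CuntzToeplitz.tensorGenRight n r)))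
    {γ : UnitAddTorus (Fin 2) → (TwistedCuntzToeplitz n m q →⋆ₐ[ℂ] TwistedCuntzToeplitz n m q)}
    (hγl : ∀ j, genLeft q m j ∈ isotypic γ (Pi.single 0 1))
    (hγr : ∀ r, genRight q n r ∈ isotypic γ (Pi.single 1 1))
    {x : TwistedCuntzToeplitz n m q} (hx : Φ x = 0) (z : UnitAddTorus (Fin 2)) :
    Φ (γ z x) = 0 := by
  obtain ⟨v, hv⟩ := W.exists_unitary z
  have hv' : ∀ p a, (v : 𝓑) * W.twist p a * star (v : 𝓑) =
      UnitAddTorus.mFourier p z • W.twist p a := by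
    intro p a
    rw [W.twist_apply, hv, smul_mul_assoc, mul_assoc, Unitary.mul_star_self_of_mem v.2, mul_one]
  have h : Φ.comp (γ z) =
      ((Unitary.conjStarAlgAut ℂ 𝓑 v : 𝓑 ≃⋆ₐ[ℂ] 𝓑) : 𝓑 →⋆ₐ[ℂ] 𝓑).comp Φ := by
    refine StarAlgHom.ext_of_generators eq_top_of_mem ?_
    rintro _ (⟨j, rfl⟩ | ⟨r, rfl⟩)
    · change Φ (γ z _) = (v : 𝓑) * Φ _ * star (v : 𝓑)
      rw [hγl j z, map_smul, hΦl, hv']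
    · change Φ (γ z _) = (v : 𝓑) * Φ _ * star (v : 𝓑)
      rw [hγr r z, map_smul, hΦr, hv']
  have h1 : Φ (γ z x) = (v : 𝓑) * Φ x * star (v : 𝓑) := congrArg (fun F => F x) h
  rw [h1, hx, mul_zero, zero_mul]

/-- The twist of a faithful representation is faithful. -/
theorem injective_of_twist (hφ : q = Real.fourierChar φ) (hπ : Function.Injective π)
    (hΦl : ∀ j, Φ (genLeft q m j) = W.twist (Pi.single 0 1) (π (CuntzToeplitz.tensorGenLeft m j)))
    (hΦr : ∀ r, Φ (genRight q n r) =
      W.twist (Pi.single 1 1) (π (CuntzToeplitz.tensorGenRight n r))) :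
    Function.Injective Φ := by
  obtain ⟨γ, hγ, hγl, hγr⟩ := exists_gauge (n := n) (m := m) (q := q)
  rw [injective_iff_map_eq_zero]
  intro x hx
  refine hγ.eq_zero_of_coeff_eq_zero fun p => ?_
  have h0 : Φ (hγ.coeff p x) = 0 := by
    have h1 := (⟨⟨Φ, map_smul Φ⟩, Φ.continuous_of_cstar⟩ :
      TwistedCuntzToeplitz n m q →L[ℂ] 𝓑).integral_comp_comm
      (continuous_integrable_torusHaar (hγ.continuous_integrand (-p) x))
    rw [← hγ.coeff_apply] at h1
    refine h1.symm.trans ?_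
    have h2 : ∀ z, Φ (UnitAddTorus.mFourier (-p) z • γ z x) = 0 := fun z => by
      rw [map_smul, apply_gauge_eq_zero hΦl hΦr hγl hγr hx, smul_zero]
    exact (integral_congr_ae (.of_forall h2)).trans (integral_zero _ _)
  refine eq_zero_of_forall_representation_eq_zero fun K _ _ _ ρ => ?_
  have h1 := norm_apply_coeff_le hφ hπ hΦl hΦr hγ hγl hγr (lpTwistSystem (-φ) K) ρ p x
  rw [h0, norm_zero] at h1
  exact norm_le_zero_iff.1 h1

theorem isClosed_range_of_injective {A B : Type*} [CStarAlgebra A] [CStarAlgebra B]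
    (f : A →⋆ₐ[ℂ] B) (hf : Function.Injective f) : IsClosed (Set.range f) :=
  (NonUnitalStarAlgHom.isometry f hf).isClosedEmbedding.isClosed_range

open CuntzToeplitz in
/-- The homogeneous components of the tensor product have twisted copies in the image of the
twisted algebra. -/
theorem coeff_mem_of_twist (hΦ : Function.Injective Φ)
    (hΦl : ∀ j, Φ (genLeft q m j) = W.twist (Pi.single 0 1) (π (CuntzToeplitz.tensorGenLeft m j)))
    (hΦr : ∀ r, Φ (genRight q n r) =
      W.twist (Pi.single 1 1) (π (CuntzToeplitz.tensorGenRight n r)))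
    (p : Fin 2 → ℤ) (a : CStarTensor (CuntzToeplitz n) (CuntzToeplitz m)) :
    isTorusAction_tensorGauge.coeff p a ∈ isotypic (tensorGauge n m) p ∧
      W.twist p (π (isTorusAction_tensorGauge.coeff p a)) ∈ Set.range Φ := by
  let G : (Fin 2 → ℤ) → Submodule ℂ (CStarTensor (CuntzToeplitz n) (CuntzToeplitz m)) := fun p =>
    { carrier := {a | a ∈ isotypic (tensorGauge n m) p ∧ ∃ x, Φ x = W.twist p (π a)}
      add_mem' := by
        rintro a b ⟨ha, x, hx⟩ ⟨hb, y, hy⟩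
        exact ⟨add_mem ha hb, x + y, by simp only [map_add, hx, hy]⟩
      zero_mem' := ⟨zero_mem _, 0, by simp⟩
      smul_mem' := by
        rintro c a ⟨ha, x, hx⟩
        exact ⟨Submodule.smul_mem _ c ha, c • x, by simp only [map_smul, hx]⟩ }
  have hmem := isTorusAction_tensorGauge.coeff_mem_closure G (fun p x hx => hx.1) ?_ ?_ ?_
    (s := Set.range (tensorGenLeft m) ∪ Set.range (tensorGenRight n)) ?_ tensor_eq_top_of_mem p a
  · have hcl : IsClosed ((isotypic (tensorGauge n m) p : Set _) ∩
        (fun a => W.twist p (π a)) ⁻¹' Set.range Φ) :=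
      (isClosed_isotypic _ p).inter ((isClosed_range_of_injective Φ hΦ).preimage
        ((W.continuous_twist p).comp π.continuous_of_cstar))
    exact closure_minimal (fun b hb => hb) hcl hmem
  · refine ⟨fun z => by rw [map_one, UnitAddTorus.mFourier_zero]; simp, 1, ?_⟩
    rw [map_one, map_one, W.twist_zero_left, map_one]
  · rintro p r a ⟨ha, x, hx⟩ b ⟨hb, y, hy⟩
    refine ⟨fun z => ?_, star (twistPhase φ p r : ℂ) • (x * y), ?_⟩
    · rw [map_mul, ha z, hb z, smul_mul_smul_comm, UnitAddTorus.mFourier_add]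
    · rw [map_smul, map_mul, hx, hy, W.twist_mul_twist, smul_smul, Complex.star_def,
        ← Circle.coe_inv_eq_conj, ← Circle.coe_mul, inv_mul_cancel, Circle.coe_one, one_smul,
        map_mul π]
  · rintro p a ⟨ha, x, hx⟩
    refine ⟨fun z => ?_, star x, ?_⟩
    · rw [map_star, ha z, star_smul, UnitAddTorus.mFourier_neg]; rfl
    · rw [map_star, hx, W.star_twist, map_star π]
  · rintro _ (⟨j, rfl⟩ | ⟨r, rfl⟩)
    · exact ⟨_, tensorGenLeft_mem_isotypic j, _, hΦl j⟩
    · exact ⟨_, tensorGenRight_mem_isotypic r, _, hΦr r⟩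

end TwistedCuntzToeplitz

end Comparison

/-! ### Rieffel's left multiplication operators -/

section RieffelSide

open CuntzToeplitz UnitAddTorus

open scoped FourierTransform

variable {n m : ℕ} {φ : ℝ} {H : Type*} [NormedAddCommGroup H] [InnerProductSpace ℂ H]
  [CompleteSpace H]

/-- The inner integral in Rieffel's formula is an inverse Fourier transform of a translate. -/
theorem integral_exp_smul_translate (f : 𝓢(EuclideanSpace ℝ (Fin 2), H))
    (x u : EuclideanSpace ℝ (Fin 2)) :
    ∫ v : EuclideanSpace ℝ (Fin 2),
      Complex.exp (2 * Real.pi * Complex.I * (inner ℝ u v : ℝ)) • f (x + v) =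
    (𝓕⁻ (f.compSubConstCLM ℂ (-x)) : 𝓢(EuclideanSpace ℝ (Fin 2), H)) u := by
  rw [SchwartzMap.fourierInv_coe, Real.fourierInv_eq']
  congr 1
  ext v
  rw [SchwartzMap.compSubConstCLM_apply, sub_neg_eq_add, add_comm v, real_inner_comm]
  congr 2
  push_cast
  ring

theorem continuous_gaugeAction (a : CStarTensor (CuntzToeplitz n) (CuntzToeplitz m)) :
    Continuous fun x => gaugeAction n m (Multiplicative.ofAdd x) a := by
  simp only [gaugeAction_apply]
  refine (isTorusAction_tensorGauge.continuous_orbit a).comp (continuous_pi fun i => ?_)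
  exact (AddCircle.continuous_mk' 1).comp (by fun_prop)

variable (π : CStarTensor (CuntzToeplitz n) (CuntzToeplitz m) →⋆ₐ[ℂ] (H →L[ℂ] H))

theorem gaugeAction_of_mem_isotypic {p : Fin 2 → ℤ}
    {a : CStarTensor (CuntzToeplitz n) (CuntzToeplitz m)} (ha : a ∈ isotypic (tensorGauge n m) p)
    (x : EuclideanSpace ℝ (Fin 2)) :
    gaugeAction n m (Multiplicative.ofAdd x) a =
      (Real.fourierChar (inner ℝ (momentum p) x) : ℂ) • a := by
  rw [gaugeAction_apply, ha, mFourier_coe]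

/-- On an element of degree `p`, Rieffel's formula reduces to Fourier inversion. -/
theorem rieffelLeftMul_of_mem_isotypic {p : Fin 2 → ℤ}
    {a : CStarTensor (CuntzToeplitz n) (CuntzToeplitz m)} (ha : a ∈ isotypic (tensorGauge n m) p)
    (f : 𝓢(EuclideanSpace ℝ (Fin 2), H)) (x : EuclideanSpace ℝ (Fin 2)) :
    rieffelLeftMul (gaugeAction n m) (thetaMatrix φ) π a f x =
      Real.fourierChar (inner ℝ (momentum p) x) • π a (f (x + thetaShift φ p)) := by
  have hskew : ∀ u, inner ℝ (momentum p) (Matrix.toEuclideanLin (thetaMatrix φ) u) =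
      -inner ℝ u (thetaShift φ p) := fun u => by
    simp [thetaShift, momentum, thetaMatrix, PiLp.inner_apply, Fin.sum_univ_two,
      Matrix.toEuclideanLin, Matrix.toLpLin, dotProduct]
    ring
  set g : 𝓢(EuclideanSpace ℝ (Fin 2), H) := f.compSubConstCLM ℂ (-x) with hg
  have h1 : ∀ u, π (gaugeAction n m
      (Multiplicative.ofAdd (x + Matrix.toEuclideanLin (thetaMatrix φ) u)) a)
        (∫ v, Complex.exp (2 * Real.pi * Complex.I * (inner ℝ u v : ℝ)) • f (x + v)) =
      Real.fourierChar (inner ℝ (momentum p) x) •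
        π a (Real.fourierChar (-inner ℝ u (thetaShift φ p)) •
          (𝓕⁻ g : 𝓢(EuclideanSpace ℝ (Fin 2), H)) u) := fun u => by
    rw [integral_exp_smul_translate, ← hg, gaugeAction_of_mem_isotypic ha, inner_add_right, hskew,
      AddChar.map_add_eq_mul, map_smul, _root_.smul_apply, Circle.smul_def, Circle.smul_def,
      map_smul, smul_smul, Circle.coe_mul]
  unfold rieffelLeftMul
  simp only [h1]
  have h2 : Integrable fun u => Real.fourierChar (-inner ℝ u (thetaShift φ p)) •
      (𝓕⁻ g : 𝓢(EuclideanSpace ℝ (Fin 2), H)) u :=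
    (Real.fourierIntegral_convergent_iff _).2 (𝓕⁻ g).integrable
  simp only [Circle.smul_def (Real.fourierChar (inner ℝ (momentum p) x))]
  rw [integral_smul, (π a).integral_comp_comm h2, ← Real.fourier_eq, ← SchwartzMap.fourier_coe,
    FourierTransform.fourier_fourierInv_eq, hg, SchwartzMap.compSubConstCLM_apply, sub_neg_eq_add,
    add_comm x]

theorem smoothVectors_of_mem_isotypic {p : Fin 2 → ℤ}
    {a : CStarTensor (CuntzToeplitz n) (CuntzToeplitz m)}
    (ha : a ∈ isotypic (tensorGauge n m) p) : a ∈ smoothVectors (gaugeAction n m) := by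
  change ContDiff ℝ ∞ fun x : EuclideanSpace ℝ (Fin 2) => gaugeAction n m (Multiplicative.ofAdd x) a
  simp only [gaugeAction_of_mem_isotypic ha, Real.fourierChar_apply]
  have h : ContDiff ℝ ∞ fun x : EuclideanSpace ℝ (Fin 2) =>
      Complex.exp (((2 * Real.pi * inner ℝ (momentum p) x : ℝ) : ℂ) * Complex.I) := by
    refine ContDiff.cexp (ContDiff.mul ?_ contDiff_const)
    exact Complex.ofRealCLM.contDiff.comp (contDiff_const.mul (contDiff_const.inner ℝ contDiff_id))
  exact h.smul contDiff_const

/-- `L_a` of an element of degree `p` is its twisted copy. -/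
theorem twist_toLp_ae_eq {p : Fin 2 → ℤ}
    {a : CStarTensor (CuntzToeplitz n) (CuntzToeplitz m)} (ha : a ∈ isotypic (tensorGauge n m) p)
    (f : 𝓢(EuclideanSpace ℝ (Fin 2), H)) :
    (lpTwistSystem φ H).twist p (π a) (f.toLp 2) =ᵐ[volume]
      rieffelLeftMul (gaugeAction n m) (thetaMatrix φ) π a f := by
  have h : (lpTwistSystem φ H).twist p (π a) (f.toLp 2) =
      weyl H (momentum p) (thetaShift φ p) (amplify 2 H (π a) (f.toLp 2)) := rfl
  rw [h]
  filter_upwards [coeFn_weyl (momentum p) (thetaShift φ p) (amplify 2 H (π a) (f.toLp 2)),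
    (measurePreserving_add_right volume (thetaShift φ p)).quasiMeasurePreserving.ae
      (coeFn_amplify (π a) (f.toLp 2 : Lp H 2 (volume : Measure (EuclideanSpace ℝ (Fin 2))))),
    (measurePreserving_add_right volume (thetaShift φ p)).quasiMeasurePreserving.ae
      (f.coeFn_toLp 2 volume)] with x h1 h2 h3
  rw [h1, h2, h3, rieffelLeftMul_of_mem_isotypic π ha]

theorem twist_mem_rieffelOperators {p : Fin 2 → ℤ}
    {a : CStarTensor (CuntzToeplitz n) (CuntzToeplitz m)} (ha : a ∈ isotypic (tensorGauge n m) p) :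
    (lpTwistSystem φ H).twist p (π a) ∈
      rieffelOperators (gaugeAction n m) (thetaMatrix φ) π :=
  ⟨a, smoothVectors_of_mem_isotypic ha, twist_toLp_ae_eq π ha⟩

/-- For fixed `f` and `x`, the value `(L_a f)(x)` depends linearly and continuously on `a`. -/
theorem hasSum_rieffelLeftMul {ι : Type*} {b : ι → CStarTensor (CuntzToeplitz n) (CuntzToeplitz m)}
    {a : CStarTensor (CuntzToeplitz n) (CuntzToeplitz m)} (hb : HasSum b a)
    (f : 𝓢(EuclideanSpace ℝ (Fin 2), H)) (x : EuclideanSpace ℝ (Fin 2)) :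
    HasSum (fun i => rieffelLeftMul (gaugeAction n m) (thetaMatrix φ) π (b i) f x)
      (rieffelLeftMul (gaugeAction n m) (thetaMatrix φ) π a f x) := by
  set h : 𝓢(EuclideanSpace ℝ (Fin 2), H) := 𝓕⁻ (f.compSubConstCLM ℂ (-x)) with hh
  let F : CStarTensor (CuntzToeplitz n) (CuntzToeplitz m) → EuclideanSpace ℝ (Fin 2) → H :=
    fun a u => π (gaugeAction n m
      (Multiplicative.ofAdd (x + Matrix.toEuclideanLin (thetaMatrix φ) u)) a) (h u)
  have hF : ∀ a, rieffelLeftMul (gaugeAction n m) (thetaMatrix φ) π a f x = ∫ u, F a u := by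
    intro a
    unfold rieffelLeftMul
    simp only [integral_exp_smul_translate, ← hh, F]
  have hle : ∀ a u, ‖F a u‖ ≤ ‖a‖ * ‖h u‖ := fun a u =>
    (ContinuousLinearMap.le_opNorm _ _).trans <| mul_le_mul_of_nonneg_right
      ((NonUnitalStarAlgHom.norm_apply_le π _).trans
        (by rw [gaugeAction_apply]; exact NonUnitalStarAlgHom.norm_apply_le (tensorGauge n m _) a))
      (norm_nonneg _)
  have hcont : ∀ a, Continuous (F a) := fun a => by
    have h1 : Continuous fun u : EuclideanSpace ℝ (Fin 2) =>
        x + Matrix.toEuclideanLin (thetaMatrix φ) u :=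
      continuous_const.add (LinearMap.continuous_of_finiteDimensional _)
    exact (π.continuous_of_cstar.comp ((continuous_gaugeAction a).comp h1)).clm_apply h.continuous
  have hint : ∀ a, Integrable (F a) := fun a =>
    (h.integrable.norm.const_mul ‖a‖).mono' (hcont a).aestronglyMeasurable
      (.of_forall (hle a))
  let R : CStarTensor (CuntzToeplitz n) (CuntzToeplitz m) →L[ℂ] H :=
    LinearMap.mkContinuous
      { toFun := fun a => ∫ u, F a u
        map_add' := fun a b => by
          rw [← integral_add (hint a) (hint b)]
          simp only [F, map_add, _root_.add_apply]
        map_smul' := fun c a => by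
          rw [RingHom.id_apply, ← integral_smul]
          simp only [F, map_smul, _root_.smul_apply] }
      (∫ u, ‖h u‖) fun a => by
        change ‖∫ u, F a u‖ ≤ _
        rw [mul_comm, ← integral_const_mul]
        exact norm_integral_le_of_norm_le (h.integrable.norm.const_mul ‖a‖) (.of_forall (hle a))
  simp only [hF]
  exact R.hasSum hb

end RieffelSide

/-! ### Decay of the Fourier coefficients of smooth vectors -/

section Decay

open CuntzToeplitz UnitAddTorus

/-- If a continuous linear map turns a curve into an exponential, it turns the `k`-th derivative of
the curve at `0` into the `k`-th power of the rate. -/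
theorem clm_iteratedDeriv_of_exp {E F : Type*} [NormedAddCommGroup E] [NormedSpace ℂ E]
    [NormedAddCommGroup F] [NormedSpace ℂ F] (l : E →L[ℂ] F) (c : ℂ) (k : ℕ) :
    ∀ (G : ℝ → E) (b : F), ContDiff ℝ ∞ G → (∀ t : ℝ, l (G t) = Complex.exp (c * t) • b) →
      l (iteratedDeriv k G 0) = c ^ k • b := by
  induction k with
  | zero => intro G b _ h; simpa using h 0
  | succ k ih =>
    intro G b hG h
    rw [iteratedDeriv_succ', ih (deriv G) (c • b) (contDiff_infty_iff_deriv.1 hG).2, smul_smul,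
      pow_succ]
    intro t
    have h1 : HasDerivAt (fun t => l (G t)) (l (deriv G t)) t :=
      (l.restrictScalars ℝ).hasFDerivAt.comp_hasDerivAt t
        ((contDiff_infty_iff_deriv.1 hG).1 t).hasDerivAt
    have h2 : HasDerivAt (fun t : ℝ => Complex.exp (c * t) • b)
        ((Complex.exp (c * t) * (c * 1)) • b) t :=
      (((hasDerivAt_id (t : ℂ)).comp_ofReal.const_mul c).cexp).smul_const b
    rw [show (fun t => l (G t)) = fun t : ℝ => Complex.exp (c * t) • b from funext h] at h1
    rw [h1.unique h2, mul_one, smul_smul]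

/-- The coefficients of a smooth vector decay like `|p|⁻³`, which is summable over `ℤ²`. -/
theorem summable_norm_coeff_of_smooth {n m : ℕ}
    {a : CStarTensor (CuntzToeplitz n) (CuntzToeplitz m)}
    (ha : a ∈ smoothVectors (gaugeAction n m)) :
    Summable fun p => ‖isTorusAction_tensorGauge.coeff p a‖ := by
  have hsm : ContDiff ℝ ∞ fun x : EuclideanSpace ℝ (Fin 2) =>
    gaugeAction n m (Multiplicative.ofAdd x) a := ha
  -- the third derivative in a coordinate direction bounds the coefficients
  have key : ∀ i : Fin 2, ∃ C : ℝ, ∀ p : Fin 2 → ℤ,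
      |(p i : ℝ)| ^ 3 * ‖isTorusAction_tensorGauge.coeff p a‖ ≤ C := by
    intro i
    let e : ℝ → EuclideanSpace ℝ (Fin 2) := fun t => t • EuclideanSpace.single i (1 : ℝ)
    let G : ℝ → CStarTensor (CuntzToeplitz n) (CuntzToeplitz m) := fun t =>
      gaugeAction n m (Multiplicative.ofAdd (e t)) a
    have hG : ContDiff ℝ ∞ G := hsm.comp (contDiff_id.smul contDiff_const)
    refine ⟨‖iteratedDeriv 3 G 0‖, fun p => ?_⟩
    have h1 : ∀ t : ℝ, isTorusAction_tensorGauge.coeff p (G t) =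
        Complex.exp (2 * Real.pi * Complex.I * p i * t) •
          isTorusAction_tensorGauge.coeff p a := by
      intro t
      have hin : inner ℝ (momentum p) (e t) = p i * t := by
        rw [show e t = t • EuclideanSpace.single i (1 : ℝ) from rfl, inner_smul_right,
          EuclideanSpace.inner_single_right, one_mul, mul_comm]
        rfl
      change isTorusAction_tensorGauge.coeff p (gaugeAction n m (Multiplicative.ofAdd (e t)) a) = _
      rw [gaugeAction_apply, IsTorusAction.coeff_action, mFourier_coe, hin, Real.fourierChar_apply]
      congr 2
      push_cast
      ring
    have h2 := clm_iteratedDeriv_of_exp (isTorusAction_tensorGauge.coeff p) _ 3 G _ hG h1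
    have h3 := isTorusAction_tensorGauge.norm_coeff_apply_le p (iteratedDeriv 3 G 0)
    rw [h2, norm_smul, norm_pow] at h3
    refine le_trans (mul_le_mul_of_nonneg_right ?_ (norm_nonneg _)) h3
    refine pow_le_pow_left₀ (abs_nonneg _) ?_ 3
    have h4 : ‖(2 * Real.pi * Complex.I * p i : ℂ)‖ = 2 * Real.pi * |(p i : ℝ)| := by
      simp [abs_of_pos Real.pi_pos]
    rw [h4]
    nlinarith [abs_nonneg (p i : ℝ), Real.pi_gt_three]
  obtain ⟨C, hC⟩ := key 0
  obtain ⟨D, hD⟩ := key 1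
  have hC0 : 0 ≤ C := by simpa using hC 0
  have hD0 : 0 ≤ D := by simpa using hD 0
  have hsum : Summable fun p : Fin 2 → ℤ =>
      (C + D) * ‖p‖ ^ (-3 : ℝ) + if p = 0 then ‖a‖ else 0 :=
    ((EisensteinSeries.summable_one_div_norm_rpow (by norm_num)).mul_left _).add
      (hasSum_ite_eq 0 _).summable
  refine hsum.of_nonneg_of_le (fun _ => norm_nonneg _) fun p => ?_
  by_cases hp : p = 0
  · rw [if_pos hp]
    have := isTorusAction_tensorGauge.norm_coeff_apply_le p a
    have h0 : 0 ≤ (C + D) * ‖p‖ ^ (-3 : ℝ) := by positivity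
    linarith
  · rw [if_neg hp, add_zero]
    have hpos : 0 < ‖p‖ := norm_pos_iff.2 hp
    have h3 : ‖p‖ ^ (-3 : ℝ) = (‖p‖ ^ 3)⁻¹ := by
      rw [Real.rpow_neg hpos.le]
      norm_cast
    rw [h3, ← div_eq_mul_inv, le_div_iff₀ (by positivity), mul_comm]
    obtain ⟨i, hi⟩ : ∃ i, ‖p‖ = |(p i : ℝ)| := by
      obtain ⟨i, hi⟩ := Finite.exists_max fun i => ‖p i‖
      refine ⟨i, ?_⟩
      rw [← Int.norm_eq_abs]
      exact le_antisymm ((pi_norm_le_iff_of_nonneg (norm_nonneg _)).2 hi) (norm_le_pi_norm p i)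
    rw [hi]
    fin_cases i
    · exact (hC p).trans (by linarith)
    · exact (hD p).trans (by linarith)

end Decay

/-! ### The range of the twisted representation -/

section Range

open CuntzToeplitz UnitAddTorus

/-- A series in `L^p` that also converges pointwise has the pointwise sum. -/
theorem ae_eq_of_hasSum_Lp {α ι E : Type*} [MeasurableSpace α] {μ : Measure α} [Countable ι]
    [NormedAddCommGroup E] {p : ENNReal} [Fact (1 ≤ p)] {g : ι → Lp E p μ} {s : Lp E p μ}
    (hg : HasSum g s) {G : ι → α → E} {S : α → E} (hgG : ∀ i, g i =ᵐ[μ] G i)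
    (hG : ∀ x, HasSum (fun i => G i x) (S x)) : s =ᵐ[μ] S := by
  classical
  have hfin : ∀ t : Finset ι, ((∑ i ∈ t, g i : Lp E p μ) : α → E) =ᵐ[μ]
      fun x => ∑ i ∈ t, G i x := by
    intro t
    induction t using Finset.induction_on with
    | empty =>
      filter_upwards [Lp.coeFn_zero E p μ] with x hx
      rw [Finset.sum_empty, Finset.sum_empty]
      exact hx
    | insert i t hi ih =>
      rw [Finset.sum_insert hi]
      filter_upwards [Lp.coeFn_add (g i) (∑ i ∈ t, g i), ih, hgG i] with x h1 h2 h3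
      rw [h1, Pi.add_apply, h2, h3, Finset.sum_insert hi]
  obtain ⟨ns, hns, hae⟩ := (tendstoInMeasure_of_tendsto_Lp hg).exists_seq_tendsto_ae'
  filter_upwards [hae, ae_all_iff.2 fun k => hfin (ns k)] with x h1 h2
  simp only [h2] at h1
  exact tendsto_nhds_unique h1 ((hG x).comp hns)

variable {n m : ℕ} {q : ℂ} {φ : ℝ} {H : Type*} [NormedAddCommGroup H] [InnerProductSpace ℂ H]
  [CompleteSpace H] {π : CStarTensor (CuntzToeplitz n) (CuntzToeplitz m) →⋆ₐ[ℂ] (H →L[ℂ] H)}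
  {Φ : TwistedCuntzToeplitz n m q →⋆ₐ[ℂ] (Lp H 2 (volume : Measure (EuclideanSpace ℝ (Fin 2)))
    →L[ℂ] Lp H 2 (volume : Measure (EuclideanSpace ℝ (Fin 2))))}

/-- `L_a` for a smooth vector `a` lies in the image of the twisted algebra: it is the absolutely
convergent sum of the operators of the homogeneous components of `a`. -/
theorem rieffelOperators_subset_range (hΦ : Function.Injective Φ)
    (hcoeff : ∀ p a, isTorusAction_tensorGauge.coeff p a ∈ isotypic (tensorGauge n m) p ∧
      (lpTwistSystem φ H).twist p (π (isTorusAction_tensorGauge.coeff p a)) ∈ Set.range Φ) :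
    rieffelOperators (gaugeAction n m) (thetaMatrix φ) π ⊆ Set.range Φ := by
  rintro T ⟨a, ha, hT⟩
  choose x hx using fun p => (hcoeff p a).2
  have hsum := summable_norm_coeff_of_smooth ha
  have hx' : Summable fun p => ‖x p‖ := by
    refine hsum.of_nonneg_of_le (fun _ => norm_nonneg _) fun p => ?_
    rw [← NonUnitalStarAlgHom.norm_map Φ hΦ, hx, TwistSystem.norm_twist]
    exact NonUnitalStarAlgHom.norm_apply_le π _
  have hxs : HasSum x (∑' p, x p) := hx'.of_norm.hasSum
  refine ⟨∑' p, x p, ?_⟩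
  have hΦs : HasSum (fun p => Φ (x p)) (Φ (∑' p, x p)) := hxs.map Φ Φ.continuous_of_cstar
  have has := isTorusAction_tensorGauge.hasSum_coeff (fun p => (hcoeff p a).1) hsum
  have hdense : DenseRange fun f : 𝓢(EuclideanSpace ℝ (Fin 2), H) =>
      f.toLp 2 (volume : Measure (EuclideanSpace ℝ (Fin 2))) :=
    SchwartzMap.denseRange_toLpCLM (E := EuclideanSpace ℝ (Fin 2)) (F := H) (p := 2)
      (μ := volume) ENNReal.ofNat_ne_top
  have hfun : (Φ (∑' p, x p) : Lp H 2 (volume : Measure (EuclideanSpace ℝ (Fin 2))) → _) = T := by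
    refine hdense.equalizer (ContinuousLinearMap.continuous _) T.continuous (funext fun f => ?_)
    refine Lp.ext (Filter.EventuallyEq.trans ?_ (hT f).symm)
    refine ae_eq_of_hasSum_Lp (g := fun p => Φ (x p) (f.toLp 2 volume)) ?_ (fun p => ?_)
      (hasSum_rieffelLeftMul π has f)
    · exact hΦs.map (ContinuousLinearMap.apply ℂ _ (f.toLp 2 volume))
        (ContinuousLinearMap.continuous _)
    · rw [hx]
      exact twist_toLp_ae_eq π (hcoeff p a).1 f
  exact DFunLike.coe_injective hfun

theorem range_eq_rieffelDeformation (hΦ : Function.Injective Φ)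
    (hΦl : ∀ j, Φ (TwistedCuntzToeplitz.genLeft q m j) =
      (lpTwistSystem φ H).twist (Pi.single 0 1) (π (tensorGenLeft m j)))
    (hΦr : ∀ r, Φ (TwistedCuntzToeplitz.genRight q n r) =
      (lpTwistSystem φ H).twist (Pi.single 1 1) (π (tensorGenRight n r))) :
    Φ.range = RieffelDeformation (gaugeAction n m) (thetaMatrix φ) π := by
  apply le_antisymm
  · have hsub : rieffelOperators (gaugeAction n m) (thetaMatrix φ) π ⊆
        RieffelDeformation (gaugeAction n m) (thetaMatrix φ) π :=
      (StarAlgebra.subset_adjoin ℂ _).trans (StarSubalgebra.le_topologicalClosure _)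
    have hcl : IsClosed ((RieffelDeformation (gaugeAction n m) (thetaMatrix φ) π).comap Φ :
        Set (TwistedCuntzToeplitz n m q)) := by
      rw [StarSubalgebra.coe_comap]
      exact (StarSubalgebra.isClosed_topologicalClosure _).preimage Φ.continuous_of_cstar
    have htop := TwistedCuntzToeplitz.eq_top_of_mem _ hcl (by
      rintro _ (⟨j, rfl⟩ | ⟨r, rfl⟩)
      · change Φ _ ∈ RieffelDeformation (gaugeAction n m) (thetaMatrix φ) π
        rw [hΦl]
        exact hsub (twist_mem_rieffelOperators π (tensorGenLeft_mem_isotypic j))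
      · change Φ _ ∈ RieffelDeformation (gaugeAction n m) (thetaMatrix φ) π
        rw [hΦr]
        exact hsub (twist_mem_rieffelOperators π (tensorGenRight_mem_isotypic r)))
    rintro _ ⟨x, rfl⟩
    have hx : x ∈ (RieffelDeformation (gaugeAction n m) (thetaMatrix φ) π).comap Φ := by
      rw [htop]; trivial
    exact hx
  · refine StarSubalgebra.topologicalClosure_minimal (StarAlgebra.adjoin_le ?_) ?_
    · exact rieffelOperators_subset_range hΦ
        (TwistedCuntzToeplitz.coeff_mem_of_twist hΦ hΦl hΦr)
    · exact TwistedCuntzToeplitz.isClosed_range_of_injective Φ hΦ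

theorem nonempty_starAlgEquiv_of_range_eq {A B : Type*} [Ring A] [StarRing A] [Algebra ℂ A]
    [StarModule ℂ A] [Ring B] [StarRing B] [Algebra ℂ B] [StarModule ℂ B]
    (f : A →⋆ₐ[ℂ] B) (hf : Function.Injective f) {S : StarSubalgebra ℂ B} (hS : f.range = S) :
    Nonempty (A ≃⋆ₐ[ℂ] S) := by
  subst hS
  exact ⟨StarAlgEquiv.ofInjective f hf⟩

set_option maxHeartbeats 1000000 in
/-- The isomorphism is a corestriction of the twisted representation. -/
theorem nonempty_starAlgEquiv_rieffelDeformation (hφ : q = Real.fourierChar φ)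
    (hπ : Function.Injective π) :
    Nonempty (TwistedCuntzToeplitz n m q ≃⋆ₐ[ℂ]
      RieffelDeformation (gaugeAction n m) (thetaMatrix φ) π) := by
  obtain ⟨Φ, hΦl, hΦr⟩ := TwistedCuntzToeplitz.exists_twist hφ (lpTwistSystem φ H) π
  have hΦ := TwistedCuntzToeplitz.injective_of_twist hφ hπ hΦl hΦr
  exact nonempty_starAlgEquiv_of_range_eq Φ hΦ (range_eq_rieffelDeformation hΦ hΦl hΦr)

end Range

end

theorem mainTheorem6 (n m : ℕ) (hn : 2 ≤ n) (hm : 2 ≤ m) (q : ℂ) (hq : ‖q‖ = 1)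
    (φ₀ : ℝ) (hφ : q = Complex.exp (2 * Real.pi * Complex.I * φ₀))
    {H : Type*} [NormedAddCommGroup H] [InnerProductSpace ℂ H] [CompleteSpace H]
    (π : CStarTensor (CuntzToeplitz n) (CuntzToeplitz m) →⋆ₐ[ℂ] (H →L[ℂ] H))
    (hπ : Function.Injective π) :
    Nonempty (TwistedCuntzToeplitz n m q ≃⋆ₐ[ℂ]
      RieffelDeformation (gaugeAction n m) (thetaMatrix φ₀) π) := by
  refine nonempty_starAlgEquiv_rieffelDeformation ?_ hπ
  rw [hφ, Real.fourierChar_apply]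
  congr 1
  push_cast
  ring
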